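/- Let $R$ be a commutative ring with unit, $\Gamma$ a group, and $\mathcal G$ a Hausdorff ample groupoid (a topological groupoid whose compact open bisections form a basis of its topology) with domain and range maps $d,r$, unit space $\mathcal G^{(0)}$, and a continuous functor $c:\mathcal G\to\Gamma$ ($\Gamma$ discrete); put $\mathcal G_\gamma=c^{-1}(\gamma)$. Let $\mathcal G^h$ be the inverse semigroup of compact open bisections contained in some $\mathcal G_\gamma$, with product $BD=\{xy : x\in B,\ y\in D,\ d(x)=r(y)\}$ and inverse $B^{-1}=\{x^{-1}:x\in B\}$. The Steinberg algebra $A_R(\mathcal G)$ is the $R$-algebra generated by symbols $t_B$ ($B\in\mathcal G^h$) subject to $t_\emptyset=0$, $t_Bt_D=t_{BD}$, and $t_B+t_D=t_{B\cup D}$ whenever $B,D$ are disjoint, contained in the same $\mathcal G_\gamma$, and $B\cup D$ is a bisection. Let $A_R(\mathcal G)_\gamma$ be the span of the $t_B$ with $B\subseteq\mathcal G_\gamma$. Let $C_R(\mathcal G^{(0)})$ be the algebra, under pointwise operations, of locally constant compactly supported functions $\mathcal G^{(0)}\to R$, and let $C_R(BB^{-1})$ be its ideal of functions vanishing outside $BB^{-1}=r(B)$.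 For $B\in\mathcal G^h$ let $\pi_B:B^{-1}B\to BB^{-1}$ be the bijection $d(x)\mapsto r(x)$, $x\in B$, and also write $\pi_B:C_R(B^{-1}B)\to C_R(BB^{-1})$, $\pi_B(f)=f\circ\pi_B^{-1}$, extended by $0$; this is a partial action $\pi$ of $\mathcal G^h$ on $C_R(\mathcal G^{(0)})$. Let $\mathcal L$ be the $R$-algebra of finite formal sums $\sum_B a_B\delta_B$ with $a_B\in C_R(BB^{-1})$ and $(a\delta_B)(b\delta_D)=\pi_B(\pi_{B^{-1}}(a)\,b)\,\delta_{BD}$, and let $C_R(\mathcal G^{(0)})\rtimes_\pi\mathcal G^h$ be the quotient of $\mathcal L$ by the two-sided ideal generated by all $a\delta_B-a\delta_D$ with $B\le D$ in the natural partial order of $\mathcal G^h$ and $a\in C_R(BB^{-1})$. Its component of degree $\gamma$ is the span of the classes of $a\delta_B$ with $B\subseteq\mathcal G_\gamma$. Then these components make both algebras $\Gamma$-graded $R$-algebras, and there are mutually inverse degree-preserving homomorphisms of $R$-algebras $$f:A_R(\mathcal G)\to C_R(\mathcal G^{(0)})\rtimes_\pi\mathcal G^h,\qquad g:C_R(\mathcal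 G^{(0)})\rtimes_\pi\mathcal G^h\to A_R(\mathcal G),$$ so $A_R(\mathcal G)\cong_{\mathrm{gr}}C_R(\mathcal G^{(0)})\rtimes_\pi\mathcal G^h$, with $f(t_D)=1_{r(D)}\delta_D$ for all $D\in\mathcal G^h$. Moreover the linear map from $A_R(\mathcal G)$ to the functions $\mathcal G\to R$ with $t_B\mapsto 1_B$ is well defined and injective, and, when elements of $A_R(\mathcal G)$ are identified with functions through it, $g(a\delta_B)(x)=a(r(x))$ if $x\in B$ and $g(a\delta_B)(x)=0$ if $x\notin B$. -/

import Mathlib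

open Topology

universe u v w

set_option linter.unusedSectionVars false

namespace AmpleSkew

noncomputable section

/-! ## Topological groupoids -/

/-- A (small) groupoid, presented by its set `G` of morphisms.  Objects are identified with the
identity morphisms; `d x` and `r x` are the domain and the range of `x`.  The product `x * y` is
meaningful only when `d x = r y`: the values of `*` at other pairs are irrelevant, no axiom
constrains them and no definition below looks at them. -/
class ArrowGroupoid (G : Type u) extends Mul G, Inv G where
  d : G → G
  r : G → G
  d_d : ∀ x, d (d x) = d x
  r_d : ∀ x, r (d x) = d x
  d_r : ∀ x, d (r x) = r x
  r_r : ∀ x, r (r x) = r x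
  d_mul : ∀ x y, d x = r y → d (x * y) = d y
  r_mul : ∀ x y, d x = r y → r (x * y) = r x
  mul_assoc : ∀ x y z, d x = r y → d y = r z → (x * y) * z = x * (y * z)
  mul_d : ∀ x, x * d x = x
  r_mul_self : ∀ x, r x * x = x
  d_inv : ∀ x, d x⁻¹ = r x
  r_inv : ∀ x, r x⁻¹ = d x
  inv_mul : ∀ x, x⁻¹ * x = d x
  mul_inv : ∀ x, x * x⁻¹ = r x

open ArrowGroupoid

section Groupoid

variable {G : Type u} [ArrowGroupoid G]

lemma inv_inv' (x : G) : (x⁻¹)⁻¹ = x := by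
  have h1 : (x⁻¹)⁻¹ * (x⁻¹ * x) = x := by
    rw [← mul_assoc _ _ _ (by rw [d_inv]) (by rw [d_inv]), inv_mul, d_inv, r_mul_self]
  have h2 : (x⁻¹)⁻¹ * (x⁻¹ * x) = (x⁻¹)⁻¹ := by
    have h := mul_d ((x⁻¹)⁻¹)
    rw [d_inv, r_inv] at h
    rw [inv_mul, h]
  rw [← h2, h1]

lemma inv_mul_cancel_left' (x y : G) (h : d x = r y) : x⁻¹ * (x * y) = y := by
  rw [← mul_assoc _ _ _ (by rw [d_inv]) h, inv_mul, h, r_mul_self]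

lemma mul_inv_cancel_left' (x y : G) (h : r x = r y) : x * (x⁻¹ * y) = y := by
  rw [← mul_assoc _ _ _ (by rw [r_inv]) (by rw [d_inv, h]), ArrowGroupoid.mul_inv, h, r_mul_self]

lemma mul_inv_cancel_right' (x y : G) (h : d x = r y) : (x * y) * y⁻¹ = x := by
  rw [mul_assoc _ _ _ h (by rw [r_inv]), ArrowGroupoid.mul_inv, ← h, mul_d]

lemma inv_mul_cancel_right' (x y : G) (h : d x = d y) : (x * y⁻¹) * y = x := by
  rw [mul_assoc _ _ _ (by rw [r_inv, h]) (by rw [d_inv]), inv_mul, ← h, mul_d]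

variable (G) in
/-- The unit space `G⁽⁰⁾`. -/
def unitSpace : Set G := Set.range (d : G → G)

/-- The domain map as a map onto the unit space. -/
def dMap (x : G) : unitSpace G := ⟨d x, x, rfl⟩

/-- The range map as a map onto the unit space. -/
def rMap (x : G) : unitSpace G := ⟨r x, r x, d_r x⟩

lemma dMap_eq_iff {x y : G} : dMap x = dMap y ↔ d x = d y := Subtype.ext_iff
lemma rMap_eq_iff {x y : G} : rMap x = rMap y ↔ r x = r y := Subtype.ext_iff
lemma dMap_eq_rMap_iff {x y : G} : dMap x = rMap y ↔ d x = r y := Subtype.ext_iff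
lemma dMap_inv (x : G) : dMap x⁻¹ = rMap x := Subtype.ext (d_inv x)
lemma rMap_inv (x : G) : rMap x⁻¹ = dMap x := Subtype.ext (r_inv x)
lemma dMap_mul {x y : G} (h : d x = r y) : dMap (x * y) = dMap y := Subtype.ext (d_mul x y h)
lemma rMap_mul {x y : G} (h : d x = r y) : rMap (x * y) = rMap x := Subtype.ext (r_mul x y h)

/-- The product `U V = {x y | x ∈ U, y ∈ V, d x = r y}` of two sets of morphisms. -/
def setMul (U V : Set G) : Set G := {z | ∃ x ∈ U, ∃ y ∈ V, d x = r y ∧ z = x * y}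

/-- The set `U⁻¹ = {x⁻¹ | x ∈ U}`. -/
def setInv (U : Set G) : Set G := {z | ∃ x ∈ U, z = x⁻¹}

lemma setInv_eq_preimage (U : Set G) : setInv U = (fun x : G => x⁻¹) ⁻¹' U := by
  ext z
  constructor
  · rintro ⟨x, hx, rfl⟩
    simpa [inv_inv'] using hx
  · intro hz
    exact ⟨z⁻¹, hz, (inv_inv' z).symm⟩

lemma setInv_eq_image (U : Set G) : setInv U = (fun x : G => x⁻¹) '' U := by
  ext z
  constructor
  · rintro ⟨x, hx, rfl⟩
    exact ⟨x, hx, rfl⟩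
  · rintro ⟨x, hx, rfl⟩
    exact ⟨x, hx, rfl⟩

/-- An open bisection: an open set `U` on which `d` and `r` restrict to homeomorphisms onto open
subsets of the unit space. -/
structure IsOpenBisection [TopologicalSpace G] (U : Set G) : Prop where
  isOpen : IsOpen U
  d_restrict : IsOpenEmbedding (U.domRestrict (dMap : G → unitSpace G))
  r_restrict : IsOpenEmbedding (U.domRestrict (rMap : G → unitSpace G))

end Groupoid

/-- Topological groupoid: inversion is continuous, and so is composition on the space of
composable pairs. -/
class IsTopologicalGroupoid (G : Type u) [TopologicalSpace G] [ArrowGroupoid G] : Prop where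
  continuous_inv : Continuous (fun x : G => x⁻¹)
  continuousOn_mul : ContinuousOn (fun p : G × G => p.1 * p.2) {p | d p.1 = r p.2}

/-- Ample groupoid: the compact open bisections form a basis of the topology. -/
class IsAmple (G : Type u) [TopologicalSpace G] [ArrowGroupoid G] : Prop
    extends IsTopologicalGroupoid G where
  basis : TopologicalSpace.IsTopologicalBasis {U : Set G | IsOpenBisection U ∧ IsCompact U}

/-- A `Γ`-grading of a topological groupoid: a functor `c : G → Γ` that is continuous for the
discrete topology of `Γ`, i.e. locally constant. -/
structure Cocycle (G : Type u) [TopologicalSpace G] [ArrowGroupoid G] (Γ : Type v) [Group Γ] where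
  toFun : G → Γ
  locallyConstant : IsLocallyConstant toFun
  map_mul : ∀ x y, d x = r y → toFun (x * y) = toFun x * toFun y

section Topological

variable {G : Type u} [TopologicalSpace G] [ArrowGroupoid G]

lemma continuous_dMap [IsTopologicalGroupoid G] : Continuous (dMap : G → unitSpace G) := by
  refine Continuous.subtype_mk ?_ _
  have h : Continuous (fun x : G => x⁻¹ * x) :=
    IsTopologicalGroupoid.continuousOn_mul.comp_continuous
      (IsTopologicalGroupoid.continuous_inv.prodMk continuous_id) (fun x => d_inv x)
  simpa only [inv_mul] using h

lemma continuous_rMap [IsTopologicalGroupoid G] : Continuous (rMap : G → unitSpace G) := by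
  have h := (continuous_dMap (G := G)).comp IsTopologicalGroupoid.continuous_inv
  have e : (dMap : G → unitSpace G) ∘ (fun x => x⁻¹) = rMap := funext dMap_inv
  rwa [e] at h

lemma isOpenMap_dMap [IsAmple G] : IsOpenMap (dMap : G → unitSpace G) := by
  rw [IsAmple.basis.isOpenMap_iff]
  intro U hU
  have := hU.1.d_restrict.isOpen_range
  rwa [Set.range_domRestrict] at this

lemma isOpenMap_rMap [IsAmple G] : IsOpenMap (rMap : G → unitSpace G) := by
  rw [IsAmple.basis.isOpenMap_iff]
  intro U hU
  have := hU.1.r_restrict.isOpen_range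
  rwa [Set.range_domRestrict] at this

lemma IsOpenBisection.d_inj {U : Set G} (h : IsOpenBisection U) {x y : G} (hx : x ∈ U)
    (hy : y ∈ U) (e : d x = d y) : x = y :=
  (Set.injOn_iff_injective.2 h.d_restrict.injective) hx hy (Subtype.ext e)

lemma IsOpenBisection.r_inj {U : Set G} (h : IsOpenBisection U) {x y : G} (hx : x ∈ U)
    (hy : y ∈ U) (e : r x = r y) : x = y :=
  (Set.injOn_iff_injective.2 h.r_restrict.injective) hx hy (Subtype.ext e)

lemma isOpenBisection_of_inj [IsAmple G] {U : Set G} (hU : IsOpen U)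
    (hd : ∀ x ∈ U, ∀ y ∈ U, d x = d y → x = y) (hr : ∀ x ∈ U, ∀ y ∈ U, r x = r y → x = y) :
    IsOpenBisection U := by
  refine ⟨hU, ?_, ?_⟩
  · refine IsOpenEmbedding.of_continuous_injective_isOpenMap
      (continuous_dMap.comp continuous_subtype_val) ?_
      (isOpenMap_dMap.comp hU.isOpenMap_subtype_val)
    exact Set.injOn_iff_injective.1 fun x hx y hy e => hd x hx y hy (dMap_eq_iff.1 e)
  · refine IsOpenEmbedding.of_continuous_injective_isOpenMap
      (continuous_rMap.comp continuous_subtype_val) ?_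
      (isOpenMap_rMap.comp hU.isOpenMap_subtype_val)
    exact Set.injOn_iff_injective.1 fun x hx y hy e => hr x hx y hy (rMap_eq_iff.1 e)

lemma isOpen_setMul [IsAmple G] {U V : Set G} (hU : IsOpen U) (hV : IsOpen V) :
    IsOpen (setMul U V) := by
  rw [isOpen_iff_mem_nhds]
  rintro z ⟨x, hx, y, hy, hxy, rfl⟩
  have hc : ContinuousOn (fun p : G × G => p.1⁻¹ * p.2) {p | r p.1 = r p.2} :=
    IsTopologicalGroupoid.continuousOn_mul.comp
      ((IsTopologicalGroupoid.continuous_inv.comp continuous_fst).prodMk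
        continuous_snd).continuousOn (fun p hp => by simpa [d_inv] using hp)
  have h0 := hc (x, x * y) (by simp [r_mul x y hxy])
  have hV' : V ∈ 𝓝 (x⁻¹ * (x * y)) := by
    rw [inv_mul_cancel_left' x y hxy]; exact hV.mem_nhds hy
  have h1 := h0.preimage_mem_nhdsWithin hV'
  rw [mem_nhdsWithin_iff_exists_mem_nhds_inter] at h1
  obtain ⟨N, hN, hsub⟩ := h1
  rw [mem_nhds_prod_iff] at hN
  obtain ⟨A, hA, W, hW, hAW⟩ := hN
  obtain ⟨A', hA'A, hA'o, hxA'⟩ := mem_nhds_iff.1 hA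
  have hO : IsOpen ((rMap : G → unitSpace G) ⁻¹' (rMap '' (U ∩ A'))) :=
    (isOpenMap_rMap _ (hU.inter hA'o)).preimage continuous_rMap
  refine Filter.mem_of_superset (Filter.inter_mem hW
    (hO.mem_nhds ⟨x, ⟨hx, hxA'⟩, (rMap_mul hxy).symm⟩)) ?_
  rintro z ⟨hzW, x', ⟨hx'U, hx'A⟩, e⟩
  have e' : r x' = r z := rMap_eq_iff.1 e
  have hz : x'⁻¹ * z ∈ V :=
    hsub (show (x', z) ∈ N ∩ {p : G × G | r p.1 = r p.2} from ⟨hAW ⟨hA'A hx'A, hzW⟩, e'⟩)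
  exact ⟨x', hx'U, x'⁻¹ * z, hz,
    by rw [r_mul _ _ (by rw [d_inv, e']), r_inv], (mul_inv_cancel_left' _ _ e').symm⟩

lemma isCompact_setMul [IsTopologicalGroupoid G] [T2Space G] {U V : Set G} (hU : IsCompact U)
    (hV : IsCompact V) : IsCompact (setMul U V) := by
  have hcl : IsClosed {p : G × G | dMap p.1 = rMap p.2} :=
    isClosed_eq (continuous_dMap.comp continuous_fst) (continuous_rMap.comp continuous_snd)
  have h := ((hU.prod hV).inter_right hcl).image_of_continuousOn
    (IsTopologicalGroupoid.continuousOn_mul.mono fun p hp => dMap_eq_rMap_iff.1 hp.2)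
  convert h using 1
  ext z
  constructor
  · rintro ⟨x, hx, y, hy, e, rfl⟩
    exact ⟨(x, y), ⟨⟨hx, hy⟩, dMap_eq_rMap_iff.2 e⟩, rfl⟩
  · rintro ⟨⟨x, y⟩, ⟨⟨hx, hy⟩, e⟩, rfl⟩
    exact ⟨x, hx, y, hy, dMap_eq_rMap_iff.1 e, rfl⟩

end Topological

/-! ## Inverse semigroups and partial skew inverse semigroup rings -/

/-- An inverse semigroup: every `s` has a unique inner inverse, written `s⁻¹`. -/
class InverseSemigroup (S : Type u) extends Semigroup S, Inv S where
  mul_inv_mul : ∀ s : S, s * s⁻¹ * s = s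
  inv_mul_inv : ∀ s : S, s⁻¹ * s * s⁻¹ = s⁻¹
  inv_unique : ∀ s t : S, s * t * s = s → t * s * t = t → t = s⁻¹

/-- The natural partial order of an inverse semigroup: `s ≤ t` iff `s = t e` for some
idempotent `e`. -/
def NatLE {S : Type u} [Semigroup S] (s t : S) : Prop := ∃ e : S, IsIdempotentElem e ∧ s = t * e

section Quotient

variable (R : Type u) {A : Type v} [CommRing R] [NonUnitalNonAssocRing A] [Module R A]

/-- The two-sided ideal (of an `R`-algebra, possibly without unit and not associative) generated
by a set. -/
def idealSpan (s : Set A) : Submodule R A :=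
  sInf {N : Submodule R A | s ⊆ N ∧ ∀ x ∈ N, ∀ a : A, a * x ∈ N ∧ x * a ∈ N}

lemma subset_idealSpan (s : Set A) : s ⊆ idealSpan R s := fun _ hx =>
  Submodule.mem_sInf.2 fun _ hN => hN.1 hx

lemma idealSpan_le {s : Set A} {N : Submodule R A} (h : s ⊆ N)
    (hN : ∀ x ∈ N, ∀ a : A, a * x ∈ N ∧ x * a ∈ N) : idealSpan R s ≤ N :=
  sInf_le ⟨h, hN⟩

lemma idealSpan_mul_left {s : Set A} {x : A} (hx : x ∈ idealSpan R s) (a : A) :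
    a * x ∈ idealSpan R s :=
  Submodule.mem_sInf.2 fun N hN => (hN.2 x (Submodule.mem_sInf.1 hx N hN) a).1

lemma idealSpan_mul_right {s : Set A} {x : A} (hx : x ∈ idealSpan R s) (a : A) :
    x * a ∈ idealSpan R s :=
  Submodule.mem_sInf.2 fun N hN => (hN.2 x (Submodule.mem_sInf.1 hx N hN) a).2

/-- The quotient of an `R`-algebra by the two-sided ideal generated by a set. -/
def AlgQuot (s : Set A) : Type v := A ⧸ idealSpan R s

namespace AlgQuot

variable (s : Set A)

instance : AddCommGroup (AlgQuot R s) := inferInstanceAs (AddCommGroup (A ⧸ idealSpan R s))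
instance : Module R (AlgQuot R s) := inferInstanceAs (Module R (A ⧸ idealSpan R s))

/-- The quotient map. -/
def mk : A →ₗ[R] AlgQuot R s := (idealSpan R s).mkQ

lemma mk_surjective : Function.Surjective (mk R s) := Submodule.mkQ_surjective _

lemma mk_eq_mk_iff {a b : A} : mk R s a = mk R s b ↔ a - b ∈ idealSpan R s :=
  Submodule.Quotient.eq _

instance : Mul (AlgQuot R s) where
  mul := Quotient.map₂ (· * ·) (by
    intro a a' h b b' h'
    have h1 := (Submodule.quotientRel_def _).1 h
    have h2 := (Submodule.quotientRel_def _).1 h'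
    refine (Submodule.quotientRel_def _).2 ?_
    have e : a * b - a' * b' = (a - a') * b + a' * (b - b') := by
      rw [sub_mul, mul_sub]; abel
    rw [e]
    exact add_mem (idealSpan_mul_right R h1 b) (idealSpan_mul_left R h2 a'))

lemma mk_mul (a b : A) : mk R s (a * b) = mk R s a * mk R s b := rfl

instance : NonUnitalNonAssocRing (AlgQuot R s) where
  left_distrib := by
    intro a b c
    obtain ⟨a, rfl⟩ := mk_surjective R s a
    obtain ⟨b, rfl⟩ := mk_surjective R s b
    obtain ⟨c, rfl⟩ := mk_surjective R s c
    simp only [← map_add, ← mk_mul, mul_add]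
  right_distrib := by
    intro a b c
    obtain ⟨a, rfl⟩ := mk_surjective R s a
    obtain ⟨b, rfl⟩ := mk_surjective R s b
    obtain ⟨c, rfl⟩ := mk_surjective R s c
    simp only [← map_add, ← mk_mul, add_mul]
  zero_mul := by
    intro a
    obtain ⟨a, rfl⟩ := mk_surjective R s a
    rw [← map_zero (mk R s), ← mk_mul, zero_mul]
  mul_zero := by
    intro a
    obtain ⟨a, rfl⟩ := mk_surjective R s a
    rw [← map_zero (mk R s), ← mk_mul, mul_zero]

end AlgQuot

end Quotient

/-- A partial action `π = (π_s, A_s, A)` of an inverse semigroup `S` on an `R`-algebra `A`: ideals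
`A_s = I s` and algebra isomorphisms `π_s : A_{s⁻¹} → A_s` such that
(i) `π_s⁻¹ = π_{s⁻¹}`; (ii) `π_s (A_{s⁻¹} ∩ A_t) ⊆ A_{st}`; (iii) `A_s ⊆ A_t` if `s ≤ t`;
(iv) `π_s (π_t x) = π_{st} x` for `x ∈ A_{t⁻¹} ∩ A_{t⁻¹ s⁻¹}`. -/
structure PartialAction (R : Type u) (S : Type v) (A : Type w) [CommRing R] [InverseSemigroup S]
    [NonUnitalRing A] [Module R A] where
  /-- the ideal `A_s` -/
  I : S → Submodule R A
  mul_mem_left : ∀ s a x, x ∈ I s → a * x ∈ I s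
  mul_mem_right : ∀ s a x, x ∈ I s → x * a ∈ I s
  /-- the isomorphism `π_s` -/
  π : ∀ s, I s⁻¹ ≃ₗ[R] I s
  map_mul : ∀ s (x y : I s⁻¹),
    (π s ⟨(x : A) * y, mul_mem_left _ _ _ y.2⟩ : A) = (π s x : A) * (π s y : A)
  symm_eq : ∀ s (y : I s) (y' : I (s⁻¹)⁻¹), (y : A) = y' → ((π s).symm y : A) = π s⁻¹ y'
  map_mem : ∀ s t (x : I s⁻¹), (x : A) ∈ I t → (π s x : A) ∈ I (s * t)
  mono : ∀ s t, NatLE s t → I s ≤ I t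
  comp : ∀ s t (x : I t⁻¹), (x : A) ∈ I (t⁻¹ * s⁻¹) →
    ∃ (h₁ : (π t x : A) ∈ I s⁻¹) (h₂ : (x : A) ∈ I (s * t)⁻¹),
      (π s ⟨π t x, h₁⟩ : A) = π (s * t) ⟨x, h₂⟩

namespace PartialAction

open scoped DirectSum

variable {R : Type u} {S : Type v} {A : Type w} [CommRing R] [InverseSemigroup S]
  [NonUnitalRing A] [Module R A]

/-- The algebra `𝓛` of finite formal sums `∑ a_s δ_s` with `a_s ∈ A_s`. -/
def FormalSums (α : PartialAction R S A) : Type (max v w) := ⨁ s, α.I s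

variable (α : PartialAction R S A)

instance : AddCommGroup α.FormalSums := inferInstanceAs (AddCommGroup (⨁ s, α.I s))
instance : Module R α.FormalSums := inferInstanceAs (Module R (⨁ s, α.I s))

open scoped Classical in
/-- The formal sum `a δ_s`, for `a ∈ A_s`. -/
def δ (s : S) : α.I s →ₗ[R] α.FormalSums := DirectSum.lof R S (fun s => α.I s) s

variable [IsScalarTower R A A] [SMulCommClass R A A]

/-- The element `π_{s⁻¹}(a) b` of `A_{s⁻¹}`, for `a ∈ A_s` and `b ∈ A`; here `π_{s⁻¹}` is written as
the inverse of `π_s`. -/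
def pullMul (s : S) (a : α.I s) (b : A) : α.I s⁻¹ :=
  ⟨((α.π s).symm a : A) * b, α.mul_mem_right _ _ _ ((α.π s).symm a).2⟩

/-- The coefficient `π_s (π_{s⁻¹}(a) b)` of `(a δ_s) (b δ_t)`. -/
def mulCoeff (s t : S) : α.I s →ₗ[R] α.I t →ₗ[R] α.I (s * t) :=
  LinearMap.mk₂ R
    (fun a b => ⟨α.π s (α.pullMul s a b), α.map_mem s t _ (α.mul_mem_left _ _ _ b.2)⟩)
    (fun a a' b => by
      have e : α.pullMul s (a + a') b = α.pullMul s a b + α.pullMul s a' b :=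
        Subtype.ext (by simp [pullMul, add_mul])
      apply Subtype.ext
      simp [e])
    (fun k a b => by
      have e : α.pullMul s (k • a) b = k • α.pullMul s a b :=
        Subtype.ext (by simp [pullMul, smul_mul_assoc])
      apply Subtype.ext
      simp [e])
    (fun a b b' => by
      have e : α.pullMul s a ((b : A) + b') = α.pullMul s a b + α.pullMul s a b' :=
        Subtype.ext (by simp [pullMul, mul_add])
      apply Subtype.ext
      simp [e])
    (fun k a b => by
      have e : α.pullMul s a (k • (b : A)) = k • α.pullMul s a b :=
        Subtype.ext (by simp [pullMul, mul_smul_comm])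
      apply Subtype.ext
      simp [e])

open scoped Classical in
/-- The multiplication of `𝓛`, as a bilinear map. -/
def mulHom : α.FormalSums →ₗ[R] α.FormalSums →ₗ[R] α.FormalSums :=
  DirectSum.toModule R S _ fun s => LinearMap.flip <|
    DirectSum.toModule R S _ fun t => LinearMap.flip <|
      (α.mulCoeff s t).compr₂ (α.δ (s * t))

instance : NonUnitalNonAssocRing α.FormalSums where
  mul x y := α.mulHom x y
  left_distrib x y z := map_add (α.mulHom x) y z
  right_distrib x y z := by
    change α.mulHom (x + y) z = _
    rw [map_add]; rfl
  zero_mul x := by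
    change α.mulHom 0 x = 0
    rw [map_zero]; rfl
  mul_zero x := map_zero (α.mulHom x)

/-- The defining rule `(a δ_s) (b δ_t) = π_s (π_{s⁻¹}(a) b) δ_{st}`. -/
lemma δ_mul_δ (s t : S) (a : α.I s) (b : α.I t) :
    α.δ s a * α.δ t b = α.δ (s * t) (α.mulCoeff s t a b) := by
  classical
  change α.mulHom _ _ = _
  unfold mulHom δ
  erw [DirectSum.toModule_lof, LinearMap.flip_apply, DirectSum.toModule_lof]
  rfl

/-- The elements `a δ_s - a δ_t` with `s ≤ t` and `a ∈ A_s`. -/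
def skewRel : Set α.FormalSums :=
  {x | ∃ (s t : S) (h : NatLE s t) (a : α.I s), x = α.δ s a - α.δ t ⟨a, α.mono s t h a.2⟩}

/-- The partial skew inverse semigroup ring `A ⋊_π S = 𝓛 / 𝓝`, where `𝓝` is the ideal generated by
all `a δ_s - a δ_t` with `s ≤ t` and `a ∈ A_s`. -/
abbrev SkewRing : Type (max v w) := AlgQuot R α.skewRel

/-- The class of `a δ_s` in `A ⋊_π S`. -/
def mkδ (s : S) (a : α.I s) : α.SkewRing := AlgQuot.mk R α.skewRel (α.δ s a)

/-- The span of all `a δ_s` with `s` in a given set `T` (below: the elements of a given degree). -/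
def component (T : Set S) : Submodule R α.SkewRing :=
  Submodule.span R {x | ∃ s ∈ T, ∃ a : α.I s, x = α.mkδ s a}

end PartialAction

/-- `A = ⨁ 𝒜 γ` and `𝒜 β * 𝒜 γ ⊆ 𝒜 (β γ)`. -/
structure IsAlgebraGrading {Γ : Type u} {R : Type v} {A : Type w} [Group Γ] [CommRing R]
    [NonUnitalNonAssocRing A] [Module R A] (𝒜 : Γ → Submodule R A) : Prop where
  indep : iSupIndep 𝒜
  iSup_eq_top : iSup 𝒜 = ⊤
  mul_mem : ∀ β γ x y, x ∈ 𝒜 β → y ∈ 𝒜 γ → x * y ∈ 𝒜 (β * γ)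

/-! ## The inverse semigroup of homogeneous compact open bisections -/

section Bisections

variable {G : Type u} [TopologicalSpace G] [ArrowGroupoid G] {Γ : Type v} [Group Γ]

/-- The set `G^h` of graded compact open bisections, i.e. those contained in some `G_γ`. -/
@[ext]
structure HomBis (c : Cocycle G Γ) where
  carrier : Set G
  isOpenBisection : IsOpenBisection carrier
  isCompact : IsCompact carrier
  graded : ∃ γ, ∀ x ∈ carrier, c.toFun x = γ

namespace HomBis

variable {c : Cocycle G Γ}

instance : Membership G (HomBis c) := ⟨fun B x => x ∈ B.carrier⟩

/-- `B ⊆ G_γ`.  (The empty bisection satisfies this for every `γ`.) -/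
def HasDegree (B : HomBis c) (γ : Γ) : Prop := ∀ x ∈ B, c.toFun x = γ

lemma d_inj (B : HomBis c) {x y : G} (hx : x ∈ B) (hy : y ∈ B) (e : d x = d y) : x = y :=
  B.isOpenBisection.d_inj hx hy e

lemma r_inj (B : HomBis c) {x y : G} (hx : x ∈ B) (hy : y ∈ B) (e : r x = r y) : x = y :=
  B.isOpenBisection.r_inj hx hy e

lemma ext_mem {B D : HomBis c} (h : ∀ x, x ∈ B ↔ x ∈ D) : B = D := HomBis.ext (Set.ext h)

lemma isOpenBisection_empty : IsOpenBisection (∅ : Set G) :=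
  ⟨isOpen_empty, .of_isEmpty _, .of_isEmpty _⟩

/-- The empty bisection, the zero of `G^h`. -/
instance : EmptyCollection (HomBis c) :=
  ⟨⟨∅, isOpenBisection_empty, isCompact_empty, 1, fun _ h => h.elim⟩⟩

lemma not_mem_empty (x : G) : ¬ x ∈ (∅ : HomBis c) := id

variable [IsAmple G]

instance : Inv (HomBis c) where
  inv B := ⟨setInv B.carrier,
    isOpenBisection_of_inj
      (by
        rw [setInv_eq_preimage]
        exact B.isOpenBisection.isOpen.preimage IsTopologicalGroupoid.continuous_inv)
      (by
        rintro _ ⟨x, hx, rfl⟩ _ ⟨y, hy, rfl⟩ e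
        rw [B.r_inj hx hy (by simpa [d_inv] using e)])
      (by
        rintro _ ⟨x, hx, rfl⟩ _ ⟨y, hy, rfl⟩ e
        rw [B.d_inj hx hy (by simpa [r_inv] using e)]),
    by
      rw [setInv_eq_image]
      exact B.isCompact.image IsTopologicalGroupoid.continuous_inv,
    by
      have h1 : ∀ x : G, c.toFun (d x) = 1 := fun x => by
        have h := c.map_mul (d x) (d x) (by rw [d_d, r_d])
        have h' := mul_d (d x)
        rw [d_d] at h'
        rw [h'] at h
        exact left_eq_mul.1 h
      obtain ⟨γ, hγ⟩ := B.graded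
      refine ⟨γ⁻¹, ?_⟩
      rintro _ ⟨x, hx, rfl⟩
      have h := c.map_mul x⁻¹ x (d_inv x)
      rw [inv_mul, h1, hγ x hx] at h
      exact eq_inv_of_mul_eq_one_left h.symm⟩

lemma mem_inv {B : HomBis c} {z : G} : z ∈ B⁻¹ ↔ ∃ x ∈ B, z = x⁻¹ := Iff.rfl

lemma inv_mem_inv {B : HomBis c} {x : G} (hx : x ∈ B) : x⁻¹ ∈ B⁻¹ := ⟨x, hx, rfl⟩

lemma inv_inv_eq (B : HomBis c) : (B⁻¹)⁻¹ = B := by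
  apply ext_mem
  intro z
  constructor
  · rintro ⟨_, ⟨x, hx, rfl⟩, rfl⟩
    rw [inv_inv']; exact hx
  · intro hz
    exact ⟨z⁻¹, ⟨z, hz, rfl⟩, (inv_inv' z).symm⟩

variable [T2Space G]

instance : Mul (HomBis c) where
  mul B D := ⟨setMul B.carrier D.carrier,
    isOpenBisection_of_inj (isOpen_setMul B.isOpenBisection.isOpen D.isOpenBisection.isOpen)
      (by
        rintro _ ⟨x, hx, y, hy, hxy, rfl⟩ _ ⟨x', hx', y', hy', hxy', rfl⟩ e
        rw [d_mul _ _ hxy, d_mul _ _ hxy'] at e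
        obtain rfl := D.d_inj hy hy' e
        rw [B.d_inj hx hx' (hxy.trans hxy'.symm)])
      (by
        rintro _ ⟨x, hx, y, hy, hxy, rfl⟩ _ ⟨x', hx', y', hy', hxy', rfl⟩ e
        rw [r_mul _ _ hxy, r_mul _ _ hxy'] at e
        obtain rfl := B.r_inj hx hx' e
        rw [D.r_inj hy hy' (hxy.symm.trans hxy')]),
    isCompact_setMul B.isCompact D.isCompact,
    by
      obtain ⟨β, hβ⟩ := B.graded
      obtain ⟨γ, hγ⟩ := D.graded
      refine ⟨β * γ, ?_⟩
      rintro _ ⟨x, hx, y, hy, hxy, rfl⟩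
      rw [c.map_mul x y hxy, hβ x hx, hγ y hy]⟩

lemma mem_mul {B D : HomBis c} {z : G} :
    z ∈ B * D ↔ ∃ x ∈ B, ∃ y ∈ D, d x = r y ∧ z = x * y := Iff.rfl

/-- If `B C B = B` and `C B C = C` then `C ⊆ B⁻¹`. -/
lemma subset_inv_of_mul {B C : HomBis c} (h : C * B * C = C) {z : G} (hz : z ∈ C) : z ∈ B⁻¹ := by
  have hz' := hz
  rw [← h] at hz'
  obtain ⟨_, ⟨x, hx, b, hb, hxb, rfl⟩, y, hy, hby, e⟩ := hz'
  rw [d_mul _ _ hxb] at hby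
  have h1 : d z = d y := by rw [e, d_mul _ _ (by rw [d_mul _ _ hxb, hby])]
  have h2 : r z = r x := by
    rw [e, r_mul _ _ (by rw [d_mul _ _ hxb, hby]), r_mul _ _ hxb]
  obtain rfl := C.d_inj hz hy h1
  obtain rfl := C.r_inj hz hx h2
  refine ⟨b, hb, ?_⟩
  have h3 : z * b = r z := by
    have h4 := ArrowGroupoid.mul_inv z
    conv_lhs at h4 => rw [e]
    rw [e] at h4
    have h5 := mul_inv_cancel_right' (z * b) z (by rw [d_mul _ _ hxb, hby])
    rw [← e] at h5
    rw [← h5, ArrowGroupoid.mul_inv]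
  have h6 := inv_mul_cancel_left' z b hxb
  rw [h3, ← d_inv, mul_d] at h6
  rw [← h6, inv_inv']

instance : InverseSemigroup (HomBis c) where
  mul_assoc A B C := by
    apply ext_mem
    intro z
    constructor
    · rintro ⟨_, ⟨x, hx, y, hy, hxy, rfl⟩, w, hw, h, rfl⟩
      rw [d_mul _ _ hxy] at h
      exact ⟨x, hx, y * w, ⟨y, hy, w, hw, h, rfl⟩, by rw [r_mul _ _ h, hxy],
        ArrowGroupoid.mul_assoc _ _ _ hxy h⟩
    · rintro ⟨x, hx, _, ⟨y, hy, w, hw, h, rfl⟩, hxy, rfl⟩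
      rw [r_mul _ _ h] at hxy
      exact ⟨x * y, ⟨x, hx, y, hy, hxy, rfl⟩, w, hw, by rw [d_mul _ _ hxy, h],
        (ArrowGroupoid.mul_assoc _ _ _ hxy h).symm⟩
  mul_inv_mul B := by
    apply ext_mem
    intro z
    constructor
    · rintro ⟨_, ⟨x, hx, _, ⟨y, hy, rfl⟩, hxy, rfl⟩, w, hw, h, rfl⟩
      rw [r_inv] at hxy
      obtain rfl := B.d_inj hx hy hxy
      rw [ArrowGroupoid.mul_inv, d_r] at h
      obtain rfl := B.r_inj hx hw h
      rw [ArrowGroupoid.mul_inv, r_mul_self]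
      exact hx
    · intro hz
      exact ⟨z * z⁻¹, ⟨z, hz, z⁻¹, ⟨z, hz, rfl⟩, (r_inv z).symm, rfl⟩, z, hz,
        by rw [ArrowGroupoid.mul_inv, d_r], by rw [ArrowGroupoid.mul_inv, r_mul_self]⟩
  inv_mul_inv B := by
    apply ext_mem
    intro z
    constructor
    · rintro ⟨_, ⟨_, ⟨x, hx, rfl⟩, y, hy, hxy, rfl⟩, _, ⟨w, hw, rfl⟩, h, rfl⟩
      rw [d_inv] at hxy
      obtain rfl := B.r_inj hx hy hxy
      rw [inv_mul, d_d, r_inv] at h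
      obtain rfl := B.d_inj hx hw h
      rw [inv_mul, ← r_inv, r_mul_self]
      exact ⟨x, hx, rfl⟩
    · rintro ⟨x, hx, rfl⟩
      exact ⟨x⁻¹ * x, ⟨x⁻¹, ⟨x, hx, rfl⟩, x, hx, d_inv x, rfl⟩, x⁻¹, ⟨x, hx, rfl⟩,
        by rw [inv_mul, d_d, r_inv], by rw [inv_mul, ← r_inv, r_mul_self]⟩
  inv_unique B C h1 h2 := by
    apply ext_mem
    intro z
    constructor
    · exact subset_inv_of_mul h2
    · rintro ⟨x, hx, rfl⟩
      obtain ⟨y, hy, rfl⟩ := subset_inv_of_mul h1 hx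
      rw [inv_inv']; exact hy

end HomBis

end Bisections

/-! ## The Steinberg algebra -/

section Steinberg

variable (R : Type w) [CommRing R] {G : Type u} [TopologicalSpace G] [ArrowGroupoid G]
  {Γ : Type v} [Group Γ] [IsAmple G] [T2Space G]

/-- The relators of the Steinberg algebra inside the semigroup algebra `R G^h`: the element `∅`,
and `B + D - B ∪ D` for disjoint `B`, `D` of the same degree whose union `E` is a bisection.
(The relations `t_B t_D = t_{BD}` already hold in the semigroup algebra.) -/
def steinbergRel (c : Cocycle G Γ) : Set (MonoidAlgebra R (HomBis c)) :=
  {MonoidAlgebra.single ∅ 1} ∪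
  {x | ∃ (B D E : HomBis c) (γ : Γ), B.HasDegree γ ∧ D.HasDegree γ ∧
    Disjoint B.carrier D.carrier ∧ E.carrier = B.carrier ∪ D.carrier ∧
    x = MonoidAlgebra.single B 1 + MonoidAlgebra.single D 1 - MonoidAlgebra.single E 1}

/-- The Steinberg algebra `A_R(G)`. -/
abbrev SteinbergAlgebra (c : Cocycle G Γ) : Type (max u w) :=
  AlgQuot R (steinbergRel R c)

variable {c : Cocycle G Γ}

/-- The generator `t_B` of the Steinberg algebra. -/
def t (B : HomBis c) : SteinbergAlgebra R c :=
  AlgQuot.mk R (steinbergRel R c) (MonoidAlgebra.single B 1)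

variable (c) in
/-- The component `A_R(G)_γ`, spanned by the `t_B` with `B ⊆ G_γ`. -/
def steinbergComponent (γ : Γ) : Submodule R (SteinbergAlgebra R c) :=
  Submodule.span R {x | ∃ B : HomBis c, B.HasDegree γ ∧ x = t R B}

variable (c) in
/-- The linear map from the semigroup algebra to functions on `G` with `B ↦ 1_B`. -/
def preEval : MonoidAlgebra R (HomBis c) →ₗ[R] (G → R) :=
  (Finsupp.linearCombination R
    (fun B : HomBis c => (B.carrier.indicator (fun _ => 1) : G → R))) ∘ₗ
    (MonoidAlgebra.coeffLinearEquiv R).toLinearMap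

lemma preEval_single (B : HomBis c) (k : R) :
    preEval R c (MonoidAlgebra.single B k) = k • B.carrier.indicator (fun _ => 1) := by
  simp [preEval]

open scoped Classical in
/-- Left translation of functions by a bisection. -/
def leftTr (B : HomBis c) : (G → R) →ₗ[R] (G → R) where
  toFun f x := if h : ∃ y ∈ B, r y = r x then f (h.choose⁻¹ * x) else 0
  map_add' f g := by ext x; by_cases h : ∃ y ∈ B, r y = r x <;> simp [h]
  map_smul' k f := by ext x; by_cases h : ∃ y ∈ B, r y = r x <;> simp [h]

open scoped Classical in
/-- Right translation of functions by a bisection. -/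
def rightTr (B : HomBis c) : (G → R) →ₗ[R] (G → R) where
  toFun f x := if h : ∃ y ∈ B, d y = d x then f (x * h.choose⁻¹) else 0
  map_add' f g := by ext x; by_cases h : ∃ y ∈ B, d y = d x <;> simp [h]
  map_smul' k f := by ext x; by_cases h : ∃ y ∈ B, d y = d x <;> simp [h]

lemma leftTr_indicator (B D : HomBis c) :
    leftTr R B (D.carrier.indicator (fun _ => 1)) = (B * D).carrier.indicator (fun _ => 1) := by
  classical
  ext x
  by_cases h : ∃ y ∈ B, r y = r x
  · obtain ⟨hy, e⟩ := h.choose_spec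
    simp only [leftTr, LinearMap.coe_mk, AddHom.coe_mk, dif_pos h]
    generalize h.choose = y at hy e ⊢
    rw [Set.indicator_apply, Set.indicator_apply]
    congr 1
    apply propext
    constructor
    · intro hD
      exact ⟨y, hy, _, hD, by rw [r_mul _ _ (by rw [d_inv, e]), r_inv],
        (mul_inv_cancel_left' y x e).symm⟩
    · rintro ⟨y', hy', z, hz, e', rfl⟩
      rw [r_mul _ _ e'] at e
      obtain rfl := B.r_inj hy hy' e
      rw [inv_mul_cancel_left' _ _ e']
      exact hz
  · simp only [leftTr, LinearMap.coe_mk, AddHom.coe_mk, dif_neg h]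
    rw [Set.indicator_of_notMem]
    rintro ⟨y', hy', z, hz, e', rfl⟩
    exact h ⟨y', hy', (r_mul _ _ e').symm⟩

lemma rightTr_indicator (B D : HomBis c) :
    rightTr R B (D.carrier.indicator (fun _ => 1)) = (D * B).carrier.indicator (fun _ => 1) := by
  classical
  ext x
  by_cases h : ∃ y ∈ B, d y = d x
  · obtain ⟨hy, e⟩ := h.choose_spec
    simp only [rightTr, LinearMap.coe_mk, AddHom.coe_mk, dif_pos h]
    generalize h.choose = y at hy e ⊢
    rw [Set.indicator_apply, Set.indicator_apply]
    congr 1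
    apply propext
    constructor
    · intro hD
      exact ⟨_, hD, y, hy, by rw [d_mul _ _ (by rw [r_inv, e]), d_inv],
        (inv_mul_cancel_right' x y e.symm).symm⟩
    · rintro ⟨z, hz, y', hy', e', rfl⟩
      rw [d_mul _ _ e'] at e
      obtain rfl := B.d_inj hy hy' e
      rw [mul_inv_cancel_right' _ _ e']
      exact hz
  · simp only [rightTr, LinearMap.coe_mk, AddHom.coe_mk, dif_neg h]
    rw [Set.indicator_of_notMem]
    rintro ⟨z, hz, y', hy', e', rfl⟩
    exact h ⟨y', hy', (d_mul _ _ e').symm⟩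

lemma preEval_single_mul (B : HomBis c) (k : R) (x : MonoidAlgebra R (HomBis c)) :
    preEval R c (MonoidAlgebra.single B k * x) = k • leftTr R B (preEval R c x) := by
  induction x using MonoidAlgebra.induction_linear with
  | zero => simp
  | add x y hx hy => simp only [mul_add, map_add, smul_add, hx, hy]
  | single D l =>
    rw [MonoidAlgebra.single_mul_single, preEval_single, preEval_single, map_smul,
      leftTr_indicator, smul_smul]

lemma preEval_mul_single (B : HomBis c) (k : R) (x : MonoidAlgebra R (HomBis c)) :
    preEval R c (x * MonoidAlgebra.single B k) = k • rightTr R B (preEval R c x) := by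
  induction x using MonoidAlgebra.induction_linear with
  | zero => simp
  | add x y hx hy => simp only [add_mul, map_add, smul_add, hx, hy]
  | single D l =>
    rw [MonoidAlgebra.single_mul_single, preEval_single, preEval_single, map_smul,
      rightTr_indicator, smul_smul, mul_comm]

variable (c) in
lemma idealSpan_le_ker_preEval :
    idealSpan R (steinbergRel R c) ≤ LinearMap.ker (preEval R c) := by
  apply idealSpan_le
  · rintro x (rfl | ⟨B, D, E, γ, -, -, hdisj, hE, rfl⟩)
    · change preEval R c _ = 0
      rw [preEval_single, one_smul]
      exact Set.indicator_empty _
    · change preEval R c _ = 0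
      rw [map_sub, map_add, preEval_single, preEval_single, preEval_single, hE,
        Set.indicator_union_of_disjoint hdisj, one_smul, one_smul, one_smul]
      exact sub_self _
  · intro x hx a
    have hx' : preEval R c x = 0 := hx
    constructor
    · change preEval R c (a * x) = 0
      induction a using MonoidAlgebra.induction_linear with
      | zero => simp
      | add a b ha hb => rw [add_mul, map_add, ha, hb, add_zero]
      | single B k => rw [preEval_single_mul, hx', map_zero, smul_zero]
    · change preEval R c (x * a) = 0
      induction a using MonoidAlgebra.induction_linear with
      | zero => simp
      | add a b ha hb => rw [mul_add, map_add, ha, hb, add_zero]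
      | single B k => rw [preEval_mul_single, hx', map_zero, smul_zero]

variable (c) in
/-- The canonical realisation of elements of the Steinberg algebra as `R`-valued functions on `G`:
the linear map `A_R(G) → R^G` with `t_B ↦ 1_B`. -/
def steinbergEval : SteinbergAlgebra R c →ₗ[R] (G → R) :=
  (idealSpan R (steinbergRel R c)).liftQ (preEval R c) (idealSpan_le_ker_preEval R c)

lemma steinbergEval_t (B : HomBis c) :
    steinbergEval R c (t R B) = B.carrier.indicator (fun _ => 1) := by
  have h : steinbergEval R c (t R B) = preEval R c (MonoidAlgebra.single B 1) := rfl
  rw [h, preEval_single, one_smul]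

end Steinberg

/-! ## The induced action on `C_R(G⁽⁰⁾)` -/

/-- `C_R(X)`: the locally constant functions `X → R` with compact support, with pointwise
operations. -/
def CR (R : Type u) (X : Type v) [CommRing R] [TopologicalSpace X] :
    NonUnitalSubalgebra R (X → R) where
  carrier := {f | IsLocallyConstant f ∧ HasCompactSupport f}
  add_mem' hf hg := ⟨hf.1.add hg.1, hf.2.add hg.2⟩
  zero_mem' := ⟨IsLocallyConstant.const 0, HasCompactSupport.zero⟩
  mul_mem' hf hg := ⟨hf.1.mul hg.1, hf.2.mul_right⟩
  smul_mem' k _ hf := ⟨hf.1.comp (fun y => k • y), hf.2.comp_left (g := fun y => k • y) (by simp)⟩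

section Action

variable (R : Type w) [CommRing R] {G : Type u} [TopologicalSpace G] [ArrowGroupoid G]
  {Γ : Type v} [Group Γ] {c : Cocycle G Γ}

open scoped Classical in
/-- The partial symmetry `π_B` of the unit space, from `d(B) = B⁻¹B` to `r(B) = BB⁻¹`; it sends
`u` to the range of the unique element of `B` with domain `u`. -/
def bisAct (B : HomBis c) : PartialEquiv (unitSpace G) (unitSpace G) where
  toFun u := if h : ∃ x ∈ B, dMap x = u then rMap h.choose else u
  invFun u := if h : ∃ x ∈ B, rMap x = u then dMap h.choose else u
  source := dMap '' B.carrier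
  target := rMap '' B.carrier
  map_source' := by
    rintro _ ⟨x, hx, rfl⟩
    have h : ∃ y ∈ B, dMap y = dMap x := ⟨x, hx, rfl⟩
    rw [dif_pos h]
    exact ⟨_, h.choose_spec.1, rfl⟩
  map_target' := by
    rintro _ ⟨x, hx, rfl⟩
    have h : ∃ y ∈ B, rMap y = rMap x := ⟨x, hx, rfl⟩
    rw [dif_pos h]
    exact ⟨_, h.choose_spec.1, rfl⟩
  left_inv' := by
    rintro _ ⟨x, hx, rfl⟩
    have h : ∃ y ∈ B, dMap y = dMap x := ⟨x, hx, rfl⟩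
    rw [dif_pos h]
    have h' : ∃ y ∈ B, rMap y = rMap h.choose := ⟨_, h.choose_spec.1, rfl⟩
    rw [dif_pos h', B.r_inj h'.choose_spec.1 h.choose_spec.1 (rMap_eq_iff.1 h'.choose_spec.2)]
    exact h.choose_spec.2
  right_inv' := by
    rintro _ ⟨x, hx, rfl⟩
    have h : ∃ y ∈ B, rMap y = rMap x := ⟨x, hx, rfl⟩
    rw [dif_pos h]
    have h' : ∃ y ∈ B, dMap y = dMap h.choose := ⟨_, h.choose_spec.1, rfl⟩
    rw [dif_pos h', B.d_inj h'.choose_spec.1 h.choose_spec.1 (dMap_eq_iff.1 h'.choose_spec.2)]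
    exact h.choose_spec.2

lemma bisAct_dMap {B : HomBis c} {x : G} (hx : x ∈ B) : bisAct B (dMap x) = rMap x := by
  classical
  have h : ∃ y ∈ B, dMap y = dMap x := ⟨x, hx, rfl⟩
  change dite _ _ _ = _
  rw [dif_pos h, B.d_inj h.choose_spec.1 hx (dMap_eq_iff.1 h.choose_spec.2)]

lemma bisAct_symm_rMap {B : HomBis c} {x : G} (hx : x ∈ B) :
    (bisAct B).symm (rMap x) = dMap x := by
  rw [← bisAct_dMap hx]
  exact (bisAct B).left_inv ⟨x, hx, rfl⟩

open scoped Classical in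
/-- `f ∘ π_B⁻¹`, a function on `BB⁻¹`, extended by zero to the unit space. -/
def pushFun (B : HomBis c) (f : unitSpace G → R) (u : unitSpace G) : R :=
  if u ∈ (bisAct B).target then f ((bisAct B).symm u) else 0

lemma pushFun_rMap {B : HomBis c} (f : unitSpace G → R) {x : G} (hx : x ∈ B) :
    pushFun R B f (rMap x) = f (dMap x) := by
  rw [pushFun, if_pos ⟨x, hx, rfl⟩, bisAct_symm_rMap hx]

lemma pushFun_of_notMem {B : HomBis c} (f : unitSpace G → R) {u : unitSpace G}
    (hu : u ∉ rMap '' B.carrier) : pushFun R B f u = 0 := if_neg hu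

/-- The ideal `C_R(BB⁻¹)` of `C_R(G⁽⁰⁾)`: functions vanishing outside `BB⁻¹ = r(B)`. -/
def rangeIdeal (B : HomBis c) : Submodule R (CR R (unitSpace G)) where
  carrier := {f | ∀ u ∉ rMap '' B.carrier, (f : unitSpace G → R) u = 0}
  add_mem' hf hg u hu := by
    change _ + _ = (0 : R)
    rw [hf u hu, hg u hu, add_zero]
  zero_mem' _ _ := rfl
  smul_mem' k f hf u hu := by
    change k • _ = (0 : R)
    rw [hf u hu, smul_zero]

variable [IsAmple G] [T2Space G]

lemma isClopen_range (B : HomBis c) : IsClopen (rMap '' B.carrier : Set (unitSpace G)) :=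
  ⟨(B.isCompact.image continuous_rMap).isClosed, isOpenMap_rMap _ B.isOpenBisection.isOpen⟩

lemma pushFun_mem (B : HomBis c) (f : unitSpace G → R) (hf : f ∈ CR R (unitSpace G)) :
    pushFun R B f ∈ CR R (unitSpace G) := by
  constructor
  · rw [IsLocallyConstant.iff_exists_open]
    intro u
    by_cases hu : u ∈ rMap '' B.carrier
    · obtain ⟨x, hx, rfl⟩ := hu
      obtain ⟨V, hV, hxV, hfV⟩ := (IsLocallyConstant.iff_exists_open f).1 hf.1 (dMap x)
      refine ⟨rMap '' (B.carrier ∩ dMap ⁻¹' V), isOpenMap_rMap _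
        (B.isOpenBisection.isOpen.inter (hV.preimage continuous_dMap)), ⟨x, ⟨hx, hxV⟩, rfl⟩, ?_⟩
      rintro _ ⟨y, ⟨hy, hyV⟩, rfl⟩
      rw [pushFun_rMap R f hy, pushFun_rMap R f hx, hfV _ hyV]
    · refine ⟨(rMap '' B.carrier)ᶜ, (isClopen_range B).isClosed.isOpen_compl, hu, ?_⟩
      intro v hv
      rw [pushFun_of_notMem R f hv, pushFun_of_notMem R f hu]
  · exact HasCompactSupport.intro (B.isCompact.image continuous_rMap)
      fun u hu => pushFun_of_notMem R f hu

/-- The isomorphism `π_B : C_R(B⁻¹B) → C_R(BB⁻¹)`, `f ↦ f ∘ π_B⁻¹`. -/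
def pushEquiv (B : HomBis c) : rangeIdeal R B⁻¹ ≃ₗ[R] rangeIdeal R B where
  toFun f := ⟨⟨pushFun R B f.1.1, pushFun_mem R B _ f.1.2⟩, fun _ hu => pushFun_of_notMem R _ hu⟩
  invFun f := ⟨⟨pushFun R B⁻¹ f.1.1, pushFun_mem R B⁻¹ _ f.1.2⟩,
    fun _ hu => pushFun_of_notMem R _ hu⟩
  map_add' f g := by
    apply Subtype.ext; apply Subtype.ext; funext u
    change pushFun R B (f.1.1 + g.1.1) u = pushFun R B f.1.1 u + pushFun R B g.1.1 u
    unfold pushFun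
    split_ifs <;> simp
  map_smul' k f := by
    apply Subtype.ext; apply Subtype.ext; funext u
    change pushFun R B (k • f.1.1) u = k • pushFun R B f.1.1 u
    unfold pushFun
    split_ifs <;> simp
  left_inv f := by
    apply Subtype.ext; apply Subtype.ext; funext u
    change pushFun R B⁻¹ (pushFun R B f.1.1) u = f.1.1 u
    by_cases hu : u ∈ rMap '' (B⁻¹).carrier
    · obtain ⟨_, ⟨x, hx, rfl⟩, rfl⟩ := hu
      rw [pushFun_rMap R _ (HomBis.inv_mem_inv hx), dMap_inv, pushFun_rMap R _ hx, rMap_inv]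
    · rw [pushFun_of_notMem R _ hu]
      exact (f.2 u hu).symm
  right_inv f := by
    apply Subtype.ext; apply Subtype.ext; funext u
    change pushFun R B (pushFun R B⁻¹ f.1.1) u = f.1.1 u
    by_cases hu : u ∈ rMap '' B.carrier
    · obtain ⟨x, hx, rfl⟩ := hu
      rw [pushFun_rMap R _ hx, ← rMap_inv, pushFun_rMap R _ (HomBis.inv_mem_inv hx), dMap_inv]
    · rw [pushFun_of_notMem R _ hu]
      exact (f.2 u hu).symm

lemma pushEquiv_coe (B : HomBis c) (f : rangeIdeal R B⁻¹) :
    ((pushEquiv R B f : CR R (unitSpace G)) : unitSpace G → R) = pushFun R B f.1.1 := rfl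

lemma pushEquiv_symm_coe (B : HomBis c) (f : rangeIdeal R B) :
    (((pushEquiv R B).symm f : CR R (unitSpace G)) : unitSpace G → R) =
      pushFun R B⁻¹ f.1.1 := rfl

lemma mem_of_isIdempotentElem {E : HomBis c} (hE : IsIdempotentElem E) {y : G} (hy : y ∈ E) :
    r y = y := by
  have hy' := hy
  rw [← hE] at hy'
  obtain ⟨a, ha, b, hb, hab, e⟩ := hy'
  have h1 : y = a := E.r_inj hy ha (by rw [e, r_mul _ _ hab])
  have h2 : y = b := E.d_inj hy hb (by rw [e, d_mul _ _ hab])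
  subst h1
  subst h2
  have h := inv_mul_cancel_left' y y hab
  rw [← e, inv_mul, hab] at h
  exact h

lemma subset_of_natLE {B D : HomBis c} (h : NatLE B D) {x : G} (hx : x ∈ B) : x ∈ D := by
  obtain ⟨E, hE, rfl⟩ := h
  obtain ⟨z, hz, y, hy, e, rfl⟩ := hx
  rw [← mem_of_isIdempotentElem hE hy, ← e, mul_d]
  exact hz

variable (c) in
/-- The action of `G^h` on `C_R(G⁽⁰⁾)` induced by its action on the unit space. -/
def inducedAction : PartialAction R (HomBis c) (CR R (unitSpace G)) where
  I := rangeIdeal R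
  mul_mem_left B a f hf u hu := by
    change _ * _ = (0 : R)
    rw [hf u hu, mul_zero]
  mul_mem_right B a f hf u hu := by
    change _ * _ = (0 : R)
    rw [hf u hu, zero_mul]
  π := pushEquiv R
  map_mul B f g := by
    apply Subtype.ext; funext u
    change pushFun R B (f.1.1 * g.1.1) u = pushFun R B f.1.1 u * pushFun R B g.1.1 u
    unfold pushFun
    split_ifs <;> simp
  symm_eq B f f' h := by
    apply Subtype.ext
    rw [pushEquiv_symm_coe, pushEquiv_coe, h]
  map_mem B D f hf u hu := by
    change pushFun R B f.1.1 u = 0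
    by_cases hB : u ∈ rMap '' B.carrier
    · obtain ⟨x, hx, rfl⟩ := hB
      rw [pushFun_rMap R _ hx]
      apply hf
      rintro ⟨y, hy, e⟩
      have e' : d x = r y := (dMap_eq_rMap_iff.1 e.symm)
      exact hu ⟨x * y, ⟨x, hx, y, hy, e', rfl⟩, rMap_mul e'⟩
    · exact pushFun_of_notMem R _ hB
  mono B D h f hf u hu := by
    apply hf
    rintro ⟨x, hx, rfl⟩
    exact hu ⟨x, subset_of_natLE h hx, rfl⟩
  comp B D f hf := by
    have key : ∀ x ∈ D, dMap x ∉ dMap '' (B * D).carrier → f.1.1 (dMap x) = 0 := by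
      intro x hx hn
      apply hf
      rintro ⟨_, ⟨_, ⟨y, hy, rfl⟩, _, ⟨z, hz, rfl⟩, hyz, rfl⟩, e⟩
      rw [rMap_mul hyz, rMap_inv] at e
      rw [d_inv, r_inv] at hyz
      exact hn ⟨z * y, ⟨z, hz, y, hy, hyz.symm, rfl⟩, by rw [dMap_mul hyz.symm, e]⟩
    refine ⟨?_, ?_, ?_⟩
    · intro u hu
      change pushFun R D f.1.1 u = 0
      by_cases hD : u ∈ rMap '' D.carrier
      · obtain ⟨x, hx, rfl⟩ := hD
        rw [pushFun_rMap R _ hx]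
        apply key x hx
        rintro ⟨_, ⟨z, hz, y, hy, hzy, rfl⟩, e⟩
        rw [dMap_mul hzy] at e
        obtain rfl := D.d_inj hy hx (dMap_eq_iff.1 e)
        exact hu ⟨z⁻¹, HomBis.inv_mem_inv hz, by rw [rMap_inv, dMap_eq_rMap_iff.2 hzy]⟩
      · exact pushFun_of_notMem R _ hD
    · intro u hu
      by_cases hD : u ∈ rMap '' (D⁻¹).carrier
      · obtain ⟨_, ⟨x, hx, rfl⟩, rfl⟩ := hD
        rw [rMap_inv] at hu ⊢
        apply key x hx
        rintro ⟨z, hz, e⟩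
        exact hu ⟨z⁻¹, HomBis.inv_mem_inv hz, by rw [rMap_inv, e]⟩
      · exact f.2 u hD
    · apply Subtype.ext; funext u
      change pushFun R B (pushFun R D f.1.1) u = pushFun R (B * D) f.1.1 u
      by_cases hBD : u ∈ rMap '' (B * D).carrier
      · obtain ⟨_, hxy, rfl⟩ := hBD
        rw [pushFun_rMap R _ hxy]
        obtain ⟨x, hx, y, hy, e, rfl⟩ := hxy
        rw [rMap_mul e, pushFun_rMap R _ hx, dMap_mul e, dMap_eq_rMap_iff.2 e, pushFun_rMap R _ hy]
      · rw [pushFun_of_notMem R _ hBD]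
        by_cases hB : u ∈ rMap '' B.carrier
        · obtain ⟨x, hx, rfl⟩ := hB
          rw [pushFun_rMap R _ hx]
          apply pushFun_of_notMem
          rintro ⟨y, hy, e⟩
          have e' : d x = r y := dMap_eq_rMap_iff.1 e.symm
          exact hBD ⟨x * y, ⟨x, hx, y, hy, e', rfl⟩, rMap_mul e'⟩
        · exact pushFun_of_notMem R _ hB

/-- The characteristic function `1_{r(B)}`, as an element of the ideal `C_R(BB⁻¹)`. -/
def oneRange (B : HomBis c) : (inducedAction R c).I B :=
  ⟨⟨(rMap '' B.carrier).indicator (fun _ => 1),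
    ⟨by
        let _ : TopologicalSpace R := ⊥
        have _ : DiscreteTopology R := ⟨rfl⟩
        exact (IsLocallyConstant.iff_continuous _).2 (continuous_const.indicator (fun a ha => by
          rw [(isClopen_range B).frontier_eq] at ha; exact ha.elim)),
      HasCompactSupport.intro (B.isCompact.image continuous_rMap)
        fun _ hu => Set.indicator_of_notMem hu _⟩⟩,
    fun u hu => by
      change (rMap '' B.carrier).indicator (fun _ => (1 : R)) u = 0
      exact Set.indicator_of_notMem hu _⟩

end Action

end

end AmpleSkew

open AmpleSkew

/-! Everything rests on reading both algebras as functions on `G`: `t_B` stands for `1_B`, and `a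
δ_B` for the function equal to `a ∘ r` on `B` and zero elsewhere.

For the Steinberg algebra this reading is faithful. Since `G` is Hausdorff, compact open bisections
are clopen, so intersections and differences of them are again homogeneous compact open bisections.
The additive relation then rewrites every element as a combination of generators `t_B` with pairwise
disjoint `B` (`exists_disjointList`). Evaluating at a point of one such `B` isolates its
coefficient, whence `steinbergEval_injective`. The grading follows, because elements of different
degrees have disjoint supports.

For the skew ring, a function `a` in `C_R(BB⁻¹)` takes finitely many values on `r(B)`, so it is a
combination of characteristic functions `1_{r(D)}` with `D ⊆ B` (`span_oneRangeOf_eq_top`). As `D ≤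
B`, the relations identify `1_{r(D)} δ_B` with `1_{r(D)} δ_D`. Hence the elements `1_{r(D)} δ_D`
span the skew ring, and they satisfy the relations of the `t_D` (`mulCoeff_oneRangeOf`,
`mkδ_oneRange_add`). This yields `f`.

To define `g` without choosing a decomposition of `a`, the function of `a δ_B` is shown to be
realised in the Steinberg algebra and pulled back through the injective evaluation. On spanning sets
`f` and `g` exchange `t_D` and `1_{r(D)} δ_D`, so they are mutually inverse and preserve degrees. -/

namespace AmpleSkew

noncomputable section

open ArrowGroupoid

/-! ### Quotient algebras, spanning sets and independence by supports -/

section Algebra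

variable {R : Type u} {A : Type v} {B : Type w} [CommRing R]
  [NonUnitalNonAssocRing A] [Module R A] [NonUnitalNonAssocRing B] [Module R B]

/-- Right multiplication by any element preserves scalars in the quotient algebra. -/
instance AlgQuot.instIsScalarTower [IsScalarTower R A A] (s : Set A) :
    IsScalarTower R (AlgQuot R s) (AlgQuot R s) where
  smul_assoc k a b := by
    obtain ⟨a, rfl⟩ := AlgQuot.mk_surjective R s a
    obtain ⟨b, rfl⟩ := AlgQuot.mk_surjective R s b
    simp only [smul_eq_mul, ← map_smul, ← AlgQuot.mk_mul, smul_mul_assoc]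

/-- Left multiplication by any element preserves scalars in the quotient algebra. -/
instance AlgQuot.instSMulCommClass [SMulCommClass R A A] (s : Set A) :
    SMulCommClass R (AlgQuot R s) (AlgQuot R s) where
  smul_comm k a b := by
    obtain ⟨a, rfl⟩ := AlgQuot.mk_surjective R s a
    obtain ⟨b, rfl⟩ := AlgQuot.mk_surjective R s b
    simp only [smul_eq_mul, ← map_smul, ← AlgQuot.mk_mul, mul_smul_comm]

/-- A multiplicative linear map killing the relators descends to the quotient algebra. -/
def AlgQuot.lift (s : Set A) (φ : A →ₗ[R] B) (hmul : ∀ x y, φ (x * y) = φ x * φ y)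
    (hs : ∀ x ∈ s, φ x = 0) : AlgQuot R s →ₙₐ[R] B :=
  let ψ : AlgQuot R s →ₗ[R] B := (idealSpan R s).liftQ φ
    (idealSpan_le R hs fun x hx a => by
      have hx' : φ x = 0 := hx
      constructor
      · change φ (a * x) = 0
        rw [hmul, hx', mul_zero]
      · change φ (x * a) = 0
        rw [hmul, hx', zero_mul])
  { ψ with
    map_zero' := ψ.map_zero
    map_mul' := fun x y => by
      obtain ⟨x, rfl⟩ := AlgQuot.mk_surjective R s x
      obtain ⟨y, rfl⟩ := AlgQuot.mk_surjective R s y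
      exact hmul x y }

/-- A linear map that is multiplicative on a spanning set is multiplicative. -/
lemma map_mul_of_span_eq_top [IsScalarTower R A A] [SMulCommClass R A A] [IsScalarTower R B B]
    [SMulCommClass R B B] (φ : A →ₗ[R] B) {X : Set A} (hX : Submodule.span R X = ⊤)
    (h : ∀ x ∈ X, ∀ y ∈ X, φ (x * y) = φ x * φ y) (x y : A) : φ (x * y) = φ x * φ y := by
  have hx : x ∈ Submodule.span R X := hX ▸ Submodule.mem_top
  have hy : y ∈ Submodule.span R X := hX ▸ Submodule.mem_top
  induction hx, hy using Submodule.span_induction₂ with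
  | mem_mem x y hx hy => exact h x hx y hy
  | zero_left y _ => simp
  | zero_right x _ => simp
  | add_left x y z _ _ _ h1 h2 => simp [add_mul, h1, h2]
  | add_right x y z _ _ _ h1 h2 => simp [mul_add, h1, h2]
  | smul_left k x y _ _ h => simp [smul_mul_assoc, h]
  | smul_right k x y _ _ h => simp [mul_smul_comm, h]

/-- The product of two spans lies in any submodule containing the products of the generators. -/
lemma mul_mem_of_mem_span [IsScalarTower R A A] [SMulCommClass R A A] {X Y : Set A}
    {N : Submodule R A} (h : ∀ x ∈ X, ∀ y ∈ Y, x * y ∈ N) {x y : A}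
    (hx : x ∈ Submodule.span R X) (hy : y ∈ Submodule.span R Y) : x * y ∈ N := by
  induction hx, hy using Submodule.span_induction₂ with
  | mem_mem x y hx hy => exact h x hx y hy
  | zero_left y _ => simp
  | zero_right x _ => simp
  | add_left x y z _ _ _ h1 h2 => rw [add_mul]; exact add_mem h1 h2
  | add_right x y z _ _ _ h1 h2 => rw [mul_add]; exact add_mem h1 h2
  | smul_left k x y _ _ h => rw [smul_mul_assoc]; exact N.smul_mem k h
  | smul_right k x y _ _ h => rw [mul_smul_comm]; exact N.smul_mem k h

/-- Submodules whose elements are realised faithfully by functions with disjoint supports are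
independent. -/
lemma iSupIndep_of_support {M X Γ : Type*} [AddCommGroup M] [Module R M] (ev : M →ₗ[R] (X → R))
    (hev : Function.Injective ev) (deg : X → Γ) (𝒜 : Γ → Submodule R M)
    (h : ∀ γ, ∀ m ∈ 𝒜 γ, ∀ x, deg x ≠ γ → ev m x = 0) : iSupIndep 𝒜 := by
  rw [iSupIndep_def]
  intro γ
  rw [Submodule.disjoint_def]
  intro m hm hm'
  apply hev
  rw [map_zero]
  funext x
  by_cases hx : deg x = γ
  -- At a point of degree `γ`, all other components lie in the kernel of evaluation at `x`, hence so
  -- does their supremum.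
  · have hle : (⨆ (β) (_ : β ≠ γ), 𝒜 β) ≤ LinearMap.ker (LinearMap.proj x ∘ₗ ev) :=
      iSup₂_le fun β hβ m hm => h β m hm x fun e => hβ (e.symm.trans hx)
    exact hle hm'
  · exact h γ m hm x hx

end Algebra

/-! ### Restrictions of bisections and the natural order as inclusion -/

section Restrict

variable {G : Type u} [TopologicalSpace G] [ArrowGroupoid G] {Γ : Type v} [Group Γ] [IsAmple G]
  {c : Cocycle G Γ}

namespace HomBis

/-- The intersection of a homogeneous compact open bisection with a clopen set. -/
def restrict (B : HomBis c) (C : Set G) (hC : IsClopen C) : HomBis c where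
  carrier := B.carrier ∩ C
  isOpenBisection := isOpenBisection_of_inj (B.isOpenBisection.isOpen.inter hC.isOpen)
    (fun _ hx _ hy e => B.d_inj hx.1 hy.1 e) (fun _ hx _ hy e => B.r_inj hx.1 hy.1 e)
  isCompact := B.isCompact.inter_right hC.isClosed
  graded := B.graded.imp fun _ h x hx => h x hx.1

variable [T2Space G]

/-- Hausdorffness makes compact sets closed; this allows one bisection to be cut along another and
along its complement. -/
lemma isClopen (B : HomBis c) : IsClopen B.carrier :=
  ⟨B.isCompact.isClosed, B.isOpenBisection.isOpen⟩

/-- A bisection contained in another one lies below it in the natural partial order. -/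
lemma natLE_of_subset {D B : HomBis c} (h : ∀ x ∈ D, x ∈ B) : NatLE D B := by
  -- `D⁻¹ * D` consists of the units `d(D)`. Right multiplication by it keeps the arrows of `B` with
  -- domain in `d(D)`, and these form `D` because `d` is injective on `B`.
  refine ⟨D⁻¹ * D, ?_, ext_mem fun z => ⟨fun hz => ?_, ?_⟩⟩
  · change D⁻¹ * D * (D⁻¹ * D) = D⁻¹ * D
    rw [← _root_.mul_assoc, InverseSemigroup.inv_mul_inv]
  · exact ⟨z, h z hz, z⁻¹ * z, ⟨z⁻¹, inv_mem_inv hz, z, hz, d_inv z, rfl⟩,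
      by rw [inv_mul, r_d], by rw [inv_mul, mul_d]⟩
  · rintro ⟨x, hx, _, ⟨_, ⟨y, hy, rfl⟩, w, hw, hyw, rfl⟩, e, rfl⟩
    rw [d_inv] at hyw
    obtain rfl := D.r_inj hy hw hyw
    rw [inv_mul, r_d] at e
    obtain rfl := B.d_inj hx (h y hy) e
    rw [inv_mul, mul_d]
    exact hy

lemma HasDegree.mul {B D : HomBis c} {β γ : Γ} (hB : B.HasDegree β) (hD : D.HasDegree γ) :
    (B * D).HasDegree (β * γ) := by
  rintro _ ⟨x, hx, y, hy, hxy, rfl⟩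
  rw [c.map_mul x y hxy, hB x hx, hD y hy]

lemma mul_subset_mul {B B' D D' : HomBis c} (h : ∀ x ∈ D, x ∈ B) (h' : ∀ x ∈ D', x ∈ B') :
    ∀ x ∈ D * D', x ∈ B * B' := by
  rintro _ ⟨x, hx, y, hy, e, rfl⟩
  exact ⟨x, h x hx, y, h' y hy, e, rfl⟩

end HomBis

end Restrict

/-! ### The Steinberg algebra: disjoint normal form and faithful evaluation -/

section Steinberg

variable {R : Type w} [CommRing R] {G : Type u} [TopologicalSpace G] [ArrowGroupoid G]
  {Γ : Type v} [Group Γ] [IsAmple G] [T2Space G] {c : Cocycle G Γ}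

variable (R) in
lemma t_mul (B D : HomBis c) : t R B * t R D = t R (B * D) := by
  unfold t
  rw [← AlgQuot.mk_mul, MonoidAlgebra.single_mul_single, mul_one]

variable (R c) in
lemma t_empty : t R (∅ : HomBis c) = 0 :=
  (Submodule.Quotient.mk_eq_zero _).2 (subset_idealSpan R _ (Or.inl rfl))

variable (R) in
lemma t_add {B D E : HomBis c} (hdisj : Disjoint B.carrier D.carrier)
    (hE : E.carrier = B.carrier ∪ D.carrier) : t R B + t R D = t R E := by
  -- The relator asks for a common degree; any degree of `E` serves, since `B` and `D` are contained
  -- in `E`.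
  obtain ⟨γ, hγ⟩ := E.graded
  rw [← sub_eq_zero]
  unfold t
  rw [← map_add, ← map_sub]
  exact (Submodule.Quotient.mk_eq_zero _).2 (subset_idealSpan R _ (Or.inr
    ⟨B, D, E, γ, fun x hx => hγ x (hE ▸ Or.inl hx), fun x hx => hγ x (hE ▸ Or.inr hx), hdisj, hE,
      rfl⟩))

variable (R) in
lemma t_eq_restrict_add (B : HomBis c) (C : Set G) (hC : IsClopen C) :
    t R B = t R (B.restrict C hC) + t R (B.restrict Cᶜ hC.compl) :=
  (t_add R (disjoint_compl_right.mono Set.inter_subset_right Set.inter_subset_right)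
    (Set.inter_union_compl _ _).symm).symm

variable (R c) in
lemma span_single_eq_top :
    Submodule.span R {x | ∃ B : HomBis c, x = MonoidAlgebra.single B (1 : R)} = ⊤ := by
  rw [eq_top_iff]
  rintro x -
  induction x using MonoidAlgebra.induction_linear with
  | zero => exact zero_mem _
  | add x y hx hy => exact add_mem hx hy
  | single B k =>
    have e : MonoidAlgebra.single B k = k • MonoidAlgebra.single B (1 : R) := by simp
    rw [e]
    exact Submodule.smul_mem _ _ (Submodule.subset_span ⟨B, rfl⟩)

variable (R c) in
lemma span_t_eq_top : Submodule.span R {x | ∃ B : HomBis c, x = t R B} = ⊤ := by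
  have h := congrArg (Submodule.map (AlgQuot.mk R (steinbergRel R c))) (span_single_eq_top R c)
  rw [Submodule.map_span, Submodule.map_top, LinearMap.range_eq_top.2 (AlgQuot.mk_surjective R _)]
    at h
  rw [← h]
  congr 1
  ext x
  constructor
  · rintro ⟨B, rfl⟩
    exact ⟨_, ⟨B, rfl⟩, rfl⟩
  · rintro ⟨_, ⟨B, rfl⟩, rfl⟩
    exact ⟨B, rfl⟩

/-- The element `∑ k t_B` of the Steinberg algebra given by a list of pairs `(k, B)`. -/
def listSum (L : List (R × HomBis c)) : SteinbergAlgebra R c :=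
  (L.map fun p => p.1 • t R p.2).sum

lemma listSum_cons (p : R × HomBis c) (L : List (R × HomBis c)) :
    listSum (p :: L) = p.1 • t R p.2 + listSum L := by
  simp [listSum]

/-- The bisections occurring in the list are pairwise disjoint. -/
def DisjointList (L : List (R × HomBis c)) : Prop :=
  L.Pairwise fun p q => Disjoint p.2.carrier q.2.carrier

/-- A multiple of a generator can be added to a sum over pairwise disjoint bisections. -/
lemma exists_disjointList_add (L : List (R × HomBis c)) (hL : DisjointList L) (k : R)
    (B : HomBis c) : ∃ L' : List (R × HomBis c), DisjointList L' ∧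
      listSum L' = k • t R B + listSum L ∧
      ∀ p ∈ L', ∀ x ∈ p.2, x ∈ B ∨ ∃ q ∈ L, x ∈ q.2 := by
  induction L generalizing B with
  | nil =>
    exact ⟨[(k, B)], List.pairwise_singleton _ _, listSum_cons _ _, fun p hp x hx => Or.inl (by
      rw [List.mem_singleton.1 hp] at hx; exact hx)⟩
  | cons q L ih =>
    obtain ⟨l, D⟩ := q
    obtain ⟨hD, hL⟩ := List.pairwise_cons.1 hL
    -- With head term `l t_D`, write `k t_B + l t_D = (k + l) t_{B ∩ D} + l t_{D \ B} + k t_{B \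
    -- D}`. The last term is absorbed into the tail by induction. The support bound `h3` keeps the
    -- resulting pieces off `D`, and so off the first two pieces.
    obtain ⟨L', h1, h2, h3⟩ := ih hL (B.restrict D.carrierᶜ D.isClopen.compl)
    refine ⟨(k + l, B.restrict D.carrier D.isClopen) ::
      (l, D.restrict B.carrierᶜ B.isClopen.compl) :: L', ?_, ?_, ?_⟩
    · have key : ∀ p ∈ L', Disjoint D.carrier p.2.carrier := by
        intro p hp
        rw [Set.disjoint_left]
        intro x hx hxp
        rcases h3 p hp x hxp with h | ⟨q, hq, hxq⟩
        · exact h.2 hx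
        · exact Set.disjoint_left.1 (hD q hq) hx hxq
      refine List.pairwise_cons.2 ⟨?_, List.pairwise_cons.2 ⟨fun p hp => ?_, h1⟩⟩
      · intro p hp
        rcases List.mem_cons.1 hp with rfl | hp
        · exact Set.disjoint_left.2 fun x hx hx' => hx'.2 hx.1
        · exact (key p hp).mono_left Set.inter_subset_right
      · exact (key p hp).mono_left Set.inter_subset_left
    · have e : D.restrict B.carrier B.isClopen = B.restrict D.carrier D.isClopen :=
        HomBis.ext (Set.inter_comm _ _)
      simp only [listSum_cons, h2]
      rw [t_eq_restrict_add R B D.carrier D.isClopen, t_eq_restrict_add R D B.carrier B.isClopen, e]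
      module
    · intro p hp x hx
      rcases List.mem_cons.1 hp with rfl | hp
      · exact Or.inl hx.1
      rcases List.mem_cons.1 hp with rfl | hp
      · exact Or.inr ⟨_, List.mem_cons_self, hx.1⟩
      · rcases h3 p hp x hx with h | ⟨q, hq, hxq⟩
        · exact Or.inl h.1
        · exact Or.inr ⟨q, List.mem_cons_of_mem _ hq, hxq⟩

/-- Every element of the Steinberg algebra is a linear combination of generators given by pairwise
disjoint bisections. -/
lemma exists_disjointList (x : SteinbergAlgebra R c) :
    ∃ L : List (R × HomBis c), DisjointList L ∧ listSum L = x := by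
  obtain ⟨x, rfl⟩ := AlgQuot.mk_surjective R _ x
  -- Two disjoint lists need not be disjoint from each other, so normal forms cannot simply be
  -- concatenated. The claim that survives addition is that adding `x` preserves having a normal
  -- form.
  suffices h : ∀ y : SteinbergAlgebra R c, (∃ L, DisjointList L ∧ listSum L = y) →
      ∃ L, DisjointList L ∧ listSum L = AlgQuot.mk R (steinbergRel R c) x + y by
    simpa using h 0 ⟨[], List.Pairwise.nil, rfl⟩
  induction x using MonoidAlgebra.induction_linear with
  | zero => intro y hy; simpa using hy
  | add a b ha hb =>
    intro y hy
    rw [map_add, _root_.add_assoc]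
    exact ha _ (hb y hy)
  | single B k =>
    rintro y ⟨L, hL, rfl⟩
    obtain ⟨L', h1, h2, -⟩ := exists_disjointList_add L hL k B
    refine ⟨L', h1, h2.trans ?_⟩
    have e : MonoidAlgebra.single B k = k • MonoidAlgebra.single B (1 : R) := by simp
    rw [e, map_smul]
    rfl

lemma steinbergEval_listSum_of_notMem (L : List (R × HomBis c)) {x : G}
    (h : ∀ p ∈ L, x ∉ p.2) : steinbergEval R c (listSum L) x = 0 := by
  induction L with
  | nil => simp [listSum]
  | cons p L ih =>
    rw [listSum_cons, map_add, map_smul, steinbergEval_t, Pi.add_apply,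
      ih fun q hq => h q (List.mem_cons_of_mem _ hq), Pi.smul_apply,
      Set.indicator_of_notMem (h p List.mem_cons_self)]
    simp

/-- At a point of the head bisection all later terms vanish, so the head coefficient is zero. If the
head bisection has no point, its generator is `t_∅ = 0`. -/
lemma listSum_eq_zero (L : List (R × HomBis c)) (hL : DisjointList L)
    (h : steinbergEval R c (listSum L) = 0) : listSum L = 0 := by
  induction L with
  | nil => rfl
  | cons p L ih =>
    obtain ⟨hp, hL⟩ := List.pairwise_cons.1 hL
    have hpt : p.1 • t R p.2 = 0 := by
      rcases p.2.carrier.eq_empty_or_nonempty with he | ⟨x, hx⟩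
      · have he' : p.2 = ∅ := HomBis.ext he
        rw [he', t_empty, smul_zero]
      · have hx' := congrFun h x
        rw [listSum_cons, map_add, map_smul, steinbergEval_t, Pi.add_apply,
          steinbergEval_listSum_of_notMem L fun q hq => Set.disjoint_left.1 (hp q hq) hx,
          Pi.smul_apply, Set.indicator_of_mem hx] at hx'
        have hk : p.1 = 0 := by simpa using hx'
        rw [hk, zero_smul]
    rw [listSum_cons, hpt, zero_add] at h ⊢
    exact ih hL h

variable (R c) in
lemma steinbergEval_injective : Function.Injective (steinbergEval R c) := by
  rw [injective_iff_map_eq_zero]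
  intro x hx
  obtain ⟨L, hL, rfl⟩ := exists_disjointList x
  exact listSum_eq_zero L hL hx

-- Elements of degree `γ` are represented by functions supported in `c⁻¹(γ)`, so faithfulness of the
-- evaluation gives independence.
variable (R c) in
lemma isAlgebraGrading_steinbergComponent : IsAlgebraGrading (steinbergComponent R c) where
  indep := by
    refine iSupIndep_of_support _ (steinbergEval_injective R c) c.toFun _ fun γ m hm x hx => ?_
    have hle : steinbergComponent R c γ ≤
        LinearMap.ker (LinearMap.proj x ∘ₗ steinbergEval R c) := by
      refine Submodule.span_le.2 ?_
      rintro _ ⟨B, hB, rfl⟩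
      change steinbergEval R c (t R B) x = 0
      rw [steinbergEval_t, Set.indicator_of_notMem fun h => hx (hB x h)]
    exact hle hm
  iSup_eq_top := by
    rw [eq_top_iff, ← span_t_eq_top, Submodule.span_le]
    rintro _ ⟨B, rfl⟩
    obtain ⟨γ, hγ⟩ := B.graded
    exact Submodule.mem_iSup_of_mem γ (Submodule.subset_span ⟨B, hγ, rfl⟩)
  mul_mem β γ x y hx hy := by
    refine mul_mem_of_mem_span ?_ hx hy
    rintro _ ⟨B, hB, rfl⟩ _ ⟨D, hD, rfl⟩
    rw [t_mul]
    exact Submodule.subset_span ⟨B * D, hB.mul hD, rfl⟩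

end Steinberg

/-! ### Spanning sets and relations in partial skew inverse semigroup rings -/

namespace PartialAction

open scoped DirectSum

variable {R : Type u} {S : Type v} {A : Type w} [CommRing R] [InverseSemigroup S]
  [NonUnitalRing A] [Module R A] (α : PartialAction R S A)
  [IsScalarTower R A A] [SMulCommClass R A A]

instance : IsScalarTower R α.FormalSums α.FormalSums where
  smul_assoc k x y := by
    change α.mulHom (k • x) y = k • α.mulHom x y
    rw [map_smul, LinearMap.smul_apply]

instance : SMulCommClass R α.FormalSums α.FormalSums where
  smul_comm k x y := by
    change k • α.mulHom x y = α.mulHom x (k • y)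
    rw [map_smul]

/-- If `X s` spans `A_s` for every `s`, then the `a δ_s` with `a ∈ X s` span the formal sums. -/
lemma span_δ_eq_top (X : ∀ s, Set (α.I s)) (hX : ∀ s, Submodule.span R (X s) = ⊤) :
    Submodule.span R {x | ∃ s, ∃ a ∈ X s, x = α.δ s a} = ⊤ := by
  classical
  rw [eq_top_iff]
  rintro x -
  induction x using DirectSum.induction_on with
  | zero => exact zero_mem _
  | add x y hx hy => exact add_mem hx hy
  | of s a =>
    have h : Submodule.span R (X s) ≤
        (Submodule.span R {x | ∃ s, ∃ a ∈ X s, x = α.δ s a}).comap (α.δ s) :=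
      Submodule.span_le.2 fun a ha => Submodule.subset_span ⟨s, a, ha, rfl⟩
    have ha : a ∈ Submodule.span R (X s) := hX s ▸ Submodule.mem_top
    convert h ha
    unfold δ
    congr!

/-- The linear map on formal sums given by linear maps on the ideals `A_s`. -/
def liftFormal {M : Type*} [AddCommGroup M] [Module R M] (φ : ∀ s, α.I s →ₗ[R] M) :
    α.FormalSums →ₗ[R] M :=
  open scoped Classical in DirectSum.toModule R S M φ

lemma liftFormal_δ {M : Type*} [AddCommGroup M] [Module R M] (φ : ∀ s, α.I s →ₗ[R] M) (s : S)
    (a : α.I s) : α.liftFormal φ (α.δ s a) = φ s a := by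
  classical
  unfold liftFormal δ
  exact DirectSum.toModule_lof _ _ _

lemma mkδ_mul_mkδ (s t : S) (a : α.I s) (b : α.I t) :
    α.mkδ s a * α.mkδ t b = α.mkδ (s * t) (α.mulCoeff s t a b) := by
  unfold mkδ
  rw [← AlgQuot.mk_mul, δ_mul_δ]

/-- The generating relation of `𝓝`, with the coefficient given separately in each ideal so that only
equality in `A` has to be checked. -/
lemma mkδ_eq_mkδ {s t : S} (h : NatLE s t) (a : α.I s) (b : α.I t) (e : (a : A) = b) :
    α.mkδ s a = α.mkδ t b := by
  obtain rfl : b = ⟨a, α.mono s t h a.2⟩ := Subtype.ext e.symm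
  exact (AlgQuot.mk_eq_mk_iff R _).2 (subset_idealSpan R _ ⟨s, t, h, a, rfl⟩)

end PartialAction

/-! ### Characteristic functions in the induced action -/

section Action

variable {R : Type w} [CommRing R] {G : Type u} [TopologicalSpace G] [ArrowGroupoid G]
  {Γ : Type v} [Group Γ] [IsAmple G] [T2Space G] {c : Cocycle G Γ}

/-- Injectivity of `r` on `B` turns membership of units in `r(D)` into membership of arrows in `D`.
-/
lemma rMap_mem_image_iff {D B : HomBis c} (h : ∀ x ∈ D, x ∈ B) {x : G} (hx : x ∈ B) :
    rMap x ∈ rMap '' D.carrier ↔ x ∈ D := by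
  constructor
  · rintro ⟨y, hy, e⟩
    rwa [← B.r_inj (h y hy) hx (rMap_eq_iff.1 e)]
  · exact fun hx' => ⟨x, hx', rfl⟩

variable (R) in
/-- The characteristic function `1_{r(D)}` as an element of `C_R(BB⁻¹)`, for `D ⊆ B`. -/
def oneRangeOf (D B : HomBis c) (h : ∀ x ∈ D, x ∈ B) : (inducedAction R c).I B :=
  ⟨(oneRange R D).1,
    (inducedAction R c).mono D B (HomBis.natLE_of_subset h) (oneRange R D).2⟩

lemma oneRangeOf_apply (D B : HomBis c) (h : ∀ x ∈ D, x ∈ B) (u : unitSpace G) :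
    (oneRangeOf R D B h).1.1 u = (rMap '' D.carrier).indicator (fun _ => 1) u := rfl

lemma oneRangeOf_rMap (D B : HomBis c) (h : ∀ x ∈ D, x ∈ B) {x : G} (hx : x ∈ B) :
    (oneRangeOf R D B h).1.1 (rMap x) = D.carrier.indicator (fun _ => 1) x := by
  classical
  rw [oneRangeOf_apply, Set.indicator_apply, Set.indicator_apply]
  exact if_congr (rMap_mem_image_iff h hx) rfl rfl

/-- The functions `1_{r(D)}` with `D ⊆ B` span `C_R(BB⁻¹)`. -/
lemma span_oneRangeOf_eq_top (B : HomBis c) :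
    Submodule.span R {a | ∃ D h, a = oneRangeOf R D B h} = ⊤ := by
  classical
  rw [eq_top_iff]
  rintro a -
  have hlc : IsLocallyConstant fun x : G => a.1.1 (rMap x) := a.1.2.1.comp_continuous continuous_rMap
  have hfin : ((fun x : G => a.1.1 (rMap x)) '' B.carrier).Finite := by
    have : CompactSpace B.carrier := isCompact_iff_compactSpace.1 B.isCompact
    have h := (hlc.comp_continuous (continuous_subtype_val (p := (· ∈ B.carrier)))).range_finite
    rwa [Set.range_comp, Subtype.range_coe] at h
  -- `D k` is the level set of `a ∘ r` in `B`. It is clopen in `B` by local constancy, and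
  -- compactness of `B` leaves finitely many values `k`.
  let D (k : R) : HomBis c := B.restrict ((fun x : G => a.1.1 (rMap x)) ⁻¹' {k})
    (hlc.isClopen_fiber k)
  have hD : ∀ k, ∀ x ∈ D k, x ∈ B := fun k x hx => hx.1
  have e : a = ∑ k ∈ hfin.toFinset, k • oneRangeOf R (D k) B (hD k) := by
    apply Subtype.ext; apply Subtype.ext; funext u
    simp only [AddSubmonoidClass.coe_finsetSum, Finset.sum_apply]
    change a.1.1 u = ∑ k ∈ hfin.toFinset, k * (oneRangeOf R (D k) B (hD k)).1.1 u
    by_cases hu : u ∈ rMap '' B.carrier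
    · obtain ⟨x, hx, rfl⟩ := hu
      simp only [oneRangeOf_rMap _ B _ hx]
      -- Each arrow `x` of `B` lies in exactly one level set, that of the value `a (r x)`.
      rw [Finset.sum_eq_single (a.1.1 (rMap x)), Set.indicator_of_mem, mul_one]
      · exact ⟨hx, rfl⟩
      · intro k _ hk
        rw [Set.indicator_of_notMem, mul_zero]
        exact fun h => hk h.2.symm
      · exact fun h => (h (hfin.mem_toFinset.2 ⟨x, hx, rfl⟩)).elim
    · rw [a.2 u hu]
      exact (Finset.sum_eq_zero fun k _ => by rw [(oneRangeOf R (D k) B (hD k)).2 u hu, mul_zero]).symm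
  rw [e]
  exact Submodule.sum_mem _ fun k _ => Submodule.smul_mem _ _ (Submodule.subset_span ⟨_, _, rfl⟩)

/-- At `r(x)` with `x ∈ B` the coefficient is `1_D(x) · 1_{r(D')}(d x)`. It is `1` exactly when `x ∈
D` is composable with an arrow of `D'`, that is, when `r(x) ∈ r(DD')`. -/
lemma mulCoeff_oneRangeOf {D B D' B' : HomBis c} (h : ∀ x ∈ D, x ∈ B) (h' : ∀ x ∈ D', x ∈ B') :
    (inducedAction R c).mulCoeff B B' (oneRangeOf R D B h) (oneRangeOf R D' B' h') =
      oneRangeOf R (D * D') (B * B') (HomBis.mul_subset_mul h h') := by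
  apply Subtype.ext; apply Subtype.ext; funext u
  change pushFun R B
    (pushFun R B⁻¹ (oneRangeOf R D B h).1.1 * (oneRangeOf R D' B' h').1.1) u = _
  by_cases hu : u ∈ rMap '' B.carrier
  · obtain ⟨x, hx, rfl⟩ := hu
    rw [pushFun_rMap R _ hx, Pi.mul_apply, ← rMap_inv, pushFun_rMap R _ (HomBis.inv_mem_inv hx),
      dMap_inv, rMap_inv, oneRangeOf_rMap D B h hx, oneRangeOf_apply, oneRangeOf_apply]
    by_cases hxD : x ∈ D
    · rw [Set.indicator_of_mem (s := D.carrier) hxD, one_mul]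
      by_cases hd : dMap x ∈ rMap '' D'.carrier
      · rw [Set.indicator_of_mem hd, Set.indicator_of_mem]
        obtain ⟨y, hy, e⟩ := hd
        have hxy : d x = r y := dMap_eq_rMap_iff.1 e.symm
        exact ⟨x * y, ⟨x, hxD, y, hy, hxy, rfl⟩, rMap_mul hxy⟩
      · rw [Set.indicator_of_notMem hd, Set.indicator_of_notMem]
        rintro ⟨_, ⟨z, hz, y, hy, hzy, rfl⟩, e⟩
        rw [rMap_mul hzy] at e
        obtain rfl := D.r_inj hz hxD (rMap_eq_iff.1 e)
        exact hd ⟨y, hy, (dMap_eq_rMap_iff.2 hzy).symm⟩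
    · rw [Set.indicator_of_notMem (s := D.carrier) hxD, zero_mul, Set.indicator_of_notMem]
      rintro ⟨_, ⟨z, hz, y, hy, hzy, rfl⟩, e⟩
      rw [rMap_mul hzy] at e
      obtain rfl := B.r_inj (h z hz) hx (rMap_eq_iff.1 e)
      exact hxD hz
  · rw [pushFun_of_notMem R _ hu, oneRangeOf_apply, Set.indicator_of_notMem]
    rintro ⟨_, ⟨z, hz, y, hy, hzy, rfl⟩, rfl⟩
    exact hu ⟨z, h z hz, (rMap_mul hzy).symm⟩

variable (R c) in
lemma span_δ_oneRangeOf_eq_top :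
    Submodule.span R {x | ∃ B, ∃ a ∈ {a | ∃ D h, a = oneRangeOf R D B h},
      x = (inducedAction R c).δ B a} = ⊤ :=
  (inducedAction R c).span_δ_eq_top _ span_oneRangeOf_eq_top

/-- Since `D ≤ B`, the ambient bisection `B` may be shrunk to `D`; this reduces the spanning set to
one element for each bisection. -/
lemma mkδ_oneRangeOf (D B : HomBis c) (h : ∀ x ∈ D, x ∈ B) :
    (inducedAction R c).mkδ B (oneRangeOf R D B h) =
      (inducedAction R c).mkδ D (oneRange R D) :=
  ((inducedAction R c).mkδ_eq_mkδ (HomBis.natLE_of_subset h) _ _ rfl).symm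

lemma mkδ_oneRange_mul (B D : HomBis c) :
    (inducedAction R c).mkδ B (oneRange R B) * (inducedAction R c).mkδ D (oneRange R D) =
      (inducedAction R c).mkδ (B * D) (oneRange R (B * D)) := by
  rw [PartialAction.mkδ_mul_mkδ]
  exact congrArg _ (mulCoeff_oneRangeOf (fun _ h => h) (fun _ h => h))

lemma mkδ_oneRange_empty : (inducedAction R c).mkδ ∅ (oneRange R ∅) = 0 := by
  have e : oneRange R (∅ : HomBis c) = 0 := by
    apply Subtype.ext; apply Subtype.ext; funext u
    change (rMap '' (∅ : HomBis c).carrier).indicator (fun _ => (1 : R)) u = 0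
    rw [Set.indicator_of_notMem]
    rintro ⟨x, hx, -⟩
    exact hx
  rw [e]
  unfold PartialAction.mkδ
  rw [map_zero, map_zero]

/-- Both summands are first moved over `E`, where they add inside the single ideal `C_R(EE⁻¹)`. The
sets `r(B)` and `r(D)` are disjoint because `r` is injective on `E`. -/
lemma mkδ_oneRange_add {B D E : HomBis c} (hdisj : Disjoint B.carrier D.carrier)
    (hE : E.carrier = B.carrier ∪ D.carrier) :
    (inducedAction R c).mkδ B (oneRange R B) + (inducedAction R c).mkδ D (oneRange R D) =
      (inducedAction R c).mkδ E (oneRange R E) := by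
  have hB : ∀ x ∈ B, x ∈ E := fun x hx => hE.ge (Or.inl hx)
  have hD : ∀ x ∈ D, x ∈ E := fun x hx => hE.ge (Or.inr hx)
  have e : oneRangeOf R B E hB + oneRangeOf R D E hD = oneRange R E := by
    apply Subtype.ext; apply Subtype.ext; funext u
    have hd : Disjoint (rMap '' B.carrier) (rMap '' D.carrier) := by
      rw [Set.disjoint_left]
      rintro _ ⟨x, hx, rfl⟩ hu
      exact Set.disjoint_left.1 hdisj hx ((rMap_mem_image_iff hD (hB x hx)).1 hu)
    change (rMap '' B.carrier).indicator (fun _ => (1 : R)) u +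
      (rMap '' D.carrier).indicator (fun _ => (1 : R)) u =
      (rMap '' E.carrier).indicator (fun _ => (1 : R)) u
    rw [hE, Set.image_union, Set.indicator_union_of_disjoint hd]
  rw [← mkδ_oneRangeOf B E hB, ← mkδ_oneRangeOf D E hD, ← e]
  unfold PartialAction.mkδ
  rw [map_add, map_add]

/-! ### The homomorphism from the Steinberg algebra to the skew ring -/

variable (R c) in
/-- The linear map from the semigroup algebra to the skew ring with `B ↦ 1_{r(B)} δ_B`. -/
def preToSkew : MonoidAlgebra R (HomBis c) →ₗ[R] (inducedAction R c).SkewRing :=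
  Finsupp.linearCombination R
    (fun B : HomBis c => (inducedAction R c).mkδ B (oneRange R B)) ∘ₗ
    (MonoidAlgebra.coeffLinearEquiv R).toLinearMap

lemma preToSkew_single (B : HomBis c) :
    preToSkew R c (MonoidAlgebra.single B 1) = (inducedAction R c).mkδ B (oneRange R B) := by
  simp [preToSkew]

variable (R c) in
/-- The homomorphism from the Steinberg algebra to the skew ring with `t_B ↦ 1_{r(B)} δ_B`. -/
def toSkew : SteinbergAlgebra R c →ₙₐ[R] (inducedAction R c).SkewRing :=
  AlgQuot.lift (steinbergRel R c) (preToSkew R c)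
    (map_mul_of_span_eq_top _ (span_single_eq_top R c) (by
      rintro _ ⟨B, rfl⟩ _ ⟨D, rfl⟩
      rw [MonoidAlgebra.single_mul_single, mul_one, preToSkew_single, preToSkew_single,
        preToSkew_single, mkδ_oneRange_mul]))
    (by
      rintro x (rfl | ⟨B, D, E, γ, -, -, hdisj, hE, rfl⟩)
      · rw [preToSkew_single, mkδ_oneRange_empty]
      · rw [map_sub, map_add, preToSkew_single, preToSkew_single, preToSkew_single,
          mkδ_oneRange_add hdisj hE, sub_self])

lemma toSkew_t (B : HomBis c) :
    toSkew R c (t R B) = (inducedAction R c).mkδ B (oneRange R B) :=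
  preToSkew_single B

/-! ### The homomorphism from the skew ring to the Steinberg algebra -/

variable (R) in
open scoped Classical in
/-- The function on `G` represented by `a δ_B`: it is `a ∘ r` on `B` and zero elsewhere. -/
def coeffEval (B : HomBis c) : (inducedAction R c).I B →ₗ[R] (G → R) where
  toFun a x := if x ∈ B then a.1.1 (rMap x) else 0
  map_add' a b := by
    funext x
    change (if x ∈ B then a.1.1 (rMap x) + b.1.1 (rMap x) else 0) =
      (if x ∈ B then a.1.1 (rMap x) else 0) + (if x ∈ B then b.1.1 (rMap x) else 0)
    split_ifs <;> simp
  map_smul' k a := by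
    funext x
    change (if x ∈ B then k * a.1.1 (rMap x) else 0) = k * (if x ∈ B then a.1.1 (rMap x) else 0)
    split_ifs <;> simp

lemma coeffEval_of_mem {B : HomBis c} (a : (inducedAction R c).I B) {x : G} (hx : x ∈ B) :
    coeffEval R B a x = a.1.1 (rMap x) := if_pos hx

lemma coeffEval_of_notMem {B : HomBis c} (a : (inducedAction R c).I B) {x : G} (hx : x ∉ B) :
    coeffEval R B a x = 0 := if_neg hx

lemma coeffEval_oneRangeOf (D B : HomBis c) (h : ∀ x ∈ D, x ∈ B) :
    coeffEval R B (oneRangeOf R D B h) = D.carrier.indicator (fun _ => 1) := by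
  funext x
  by_cases hx : x ∈ B
  · rw [coeffEval_of_mem _ hx, oneRangeOf_rMap D B h hx]
  · rw [coeffEval_of_notMem _ hx, Set.indicator_of_notMem fun hx' => hx (h x hx')]

/-- By linearity it suffices to take `a = 1_{r(D)}` with `D ⊆ B`, whose function is `1_D`, the image
of `t_D`. With injectivity of the evaluation this makes the preimage of `a δ_B` unique. -/
lemma coeffEval_mem_range (B : HomBis c) (a : (inducedAction R c).I B) :
    coeffEval R B a ∈ LinearMap.range (steinbergEval R c) := by
  have hle : Submodule.span R {a | ∃ D h, a = oneRangeOf R D B h} ≤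
      (LinearMap.range (steinbergEval R c)).comap (coeffEval R B) := by
    refine Submodule.span_le.2 ?_
    rintro _ ⟨D, h, rfl⟩
    exact ⟨t R D, by rw [steinbergEval_t, coeffEval_oneRangeOf]⟩
  exact hle (span_oneRangeOf_eq_top (R := R) B ▸ Submodule.mem_top)

variable (R) in
/-- The element of the Steinberg algebra representing the same function as `a δ_B`. -/
def coeffToSteinberg (B : HomBis c) : (inducedAction R c).I B →ₗ[R] SteinbergAlgebra R c :=
  (LinearEquiv.ofInjective _ (steinbergEval_injective R c)).symm.toLinearMap ∘ₗ
    (coeffEval R B).codRestrict _ (coeffEval_mem_range B)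

lemma steinbergEval_coeffToSteinberg (B : HomBis c) (a : (inducedAction R c).I B) :
    steinbergEval R c (coeffToSteinberg R B a) = coeffEval R B a :=
  congrArg Subtype.val ((LinearEquiv.ofInjective _ (steinbergEval_injective R c)).apply_symm_apply
    ⟨coeffEval R B a, coeffEval_mem_range B a⟩)

lemma coeffToSteinberg_oneRangeOf (D B : HomBis c) (h : ∀ x ∈ D, x ∈ B) :
    coeffToSteinberg R B (oneRangeOf R D B h) = t R D :=
  steinbergEval_injective R c (by
    rw [steinbergEval_coeffToSteinberg, coeffEval_oneRangeOf, steinbergEval_t])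

variable (R c) in
/-- The homomorphism from the skew ring to the Steinberg algebra sending `a δ_B` to the element
represented by the function equal to `a ∘ r` on `B` and to zero elsewhere. -/
def ofSkew : (inducedAction R c).SkewRing →ₙₐ[R] SteinbergAlgebra R c :=
  AlgQuot.lift (inducedAction R c).skewRel
    ((inducedAction R c).liftFormal fun B => coeffToSteinberg R B)
    -- On the generators `1_{r(D)} δ_B` of `𝓛`, which go to `t_D`, multiplicativity is the identity
    -- `t_D t_{D'} = t_{DD'}`.
    (map_mul_of_span_eq_top _ (span_δ_oneRangeOf_eq_top R c) (by
      rintro _ ⟨B, _, ⟨D, h, rfl⟩, rfl⟩ _ ⟨B', _, ⟨D', h', rfl⟩, rfl⟩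
      rw [PartialAction.δ_mul_δ, mulCoeff_oneRangeOf, PartialAction.liftFormal_δ,
        PartialAction.liftFormal_δ, PartialAction.liftFormal_δ, coeffToSteinberg_oneRangeOf,
        coeffToSteinberg_oneRangeOf, coeffToSteinberg_oneRangeOf, t_mul]))
    (by
      rintro _ ⟨B, D, h, a, rfl⟩
      rw [map_sub, PartialAction.liftFormal_δ, PartialAction.liftFormal_δ, sub_eq_zero]
      apply steinbergEval_injective R c
      rw [steinbergEval_coeffToSteinberg, steinbergEval_coeffToSteinberg]
      funext x
      by_cases hB : x ∈ B
      · rw [coeffEval_of_mem _ hB, coeffEval_of_mem _ (subset_of_natLE h hB)]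
      · rw [coeffEval_of_notMem _ hB]
        by_cases hD : x ∈ D
        · rw [coeffEval_of_mem _ hD]
          -- For `x` in `D` but not in `B`, injectivity of `r` on `D` gives `r(x) ∉ r(B)`, where `a`
          -- vanishes.
          exact (a.2 _ fun hx => hB
            ((rMap_mem_image_iff (fun _ => subset_of_natLE h) hD).1 hx)).symm
        · rw [coeffEval_of_notMem _ hD])

/-! ### The two homomorphisms are mutually inverse -/

lemma ofSkew_mkδ (B : HomBis c) (a : (inducedAction R c).I B) :
    ofSkew R c ((inducedAction R c).mkδ B a) = coeffToSteinberg R B a :=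
  PartialAction.liftFormal_δ _ _ B a

lemma ofSkew_mkδ_oneRange (B : HomBis c) :
    ofSkew R c ((inducedAction R c).mkδ B (oneRange R B)) = t R B :=
  (ofSkew_mkδ B _).trans (coeffToSteinberg_oneRangeOf B B fun _ h => h)

lemma ofSkew_toSkew (x : SteinbergAlgebra R c) : ofSkew R c (toSkew R c x) = x := by
  have hx : x ∈ Submodule.span R {x | ∃ B : HomBis c, x = t R B} :=
    span_t_eq_top R c ▸ Submodule.mem_top
  induction hx using Submodule.span_induction with
  | mem x h =>
    obtain ⟨B, rfl⟩ := h
    rw [toSkew_t, ofSkew_mkδ_oneRange]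
  | zero => rw [map_zero, map_zero]
  | add x y _ _ hx hy => rw [map_add, map_add, hx, hy]
  | smul k x _ hx => rw [map_smul, map_smul, hx]

/-- By linearity `a = 1_{r(D)}` with `D ⊆ B`. The composite then gives `1_{r(D)} δ_D`, which equals
`1_{r(D)} δ_B` by the relations of the skew ring. -/
lemma toSkew_coeffToSteinberg (B : HomBis c) (a : (inducedAction R c).I B) :
    toSkew R c (coeffToSteinberg R B a) = (inducedAction R c).mkδ B a := by
  have ha : a ∈ Submodule.span R {a | ∃ D h, a = oneRangeOf R D B h} :=
    span_oneRangeOf_eq_top (R := R) B ▸ Submodule.mem_top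
  unfold PartialAction.mkδ
  induction ha using Submodule.span_induction with
  | mem a h =>
    obtain ⟨D, h, rfl⟩ := h
    rw [coeffToSteinberg_oneRangeOf, toSkew_t]
    exact (mkδ_oneRangeOf D B h).symm
  | zero => simp only [map_zero]
  | add x y _ _ hx hy => simp only [map_add, hx, hy]
  | smul k x _ hx => simp only [map_smul, hx]

variable (R c) in
lemma span_mkδ_eq_top :
    Submodule.span R {y | ∃ B a, y = (inducedAction R c).mkδ B a} = ⊤ := by
  rw [eq_top_iff]
  rintro y -
  obtain ⟨y, rfl⟩ := AlgQuot.mk_surjective R _ y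
  have hy : y ∈ Submodule.span R {x | ∃ B, ∃ a ∈ Set.univ, x = (inducedAction R c).δ B a} :=
    (inducedAction R c).span_δ_eq_top (fun _ => Set.univ) (fun _ => Submodule.span_univ) ▸
      Submodule.mem_top
  induction hy using Submodule.span_induction with
  | mem y h =>
    obtain ⟨B, a, -, rfl⟩ := h
    exact Submodule.subset_span ⟨B, a, rfl⟩
  | zero => rw [map_zero]; exact zero_mem _
  | add x y _ _ hx hy => rw [map_add]; exact add_mem hx hy
  | smul k x _ hx => rw [map_smul]; exact Submodule.smul_mem _ k hx

lemma toSkew_ofSkew (y : (inducedAction R c).SkewRing) : toSkew R c (ofSkew R c y) = y := by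
  have hy : y ∈ Submodule.span R {y | ∃ B a, y = (inducedAction R c).mkδ B a} :=
    span_mkδ_eq_top R c ▸ Submodule.mem_top
  induction hy using Submodule.span_induction with
  | mem y h =>
    obtain ⟨B, a, rfl⟩ := h
    rw [ofSkew_mkδ, toSkew_coeffToSteinberg]
  | zero => rw [map_zero, map_zero]
  | add x y _ _ hx hy => rw [map_add, map_add, hx, hy]
  | smul k x _ hx => rw [map_smul, map_smul, hx]

/-! ### Degrees and the grading of the skew ring -/

lemma toSkew_mem_component {γ : Γ} {x : SteinbergAlgebra R c} (hx : x ∈ steinbergComponent R c γ) :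
    toSkew R c x ∈ (inducedAction R c).component {B : HomBis c | B.HasDegree γ} := by
  induction hx using Submodule.span_induction with
  | mem x h =>
    obtain ⟨B, hB, rfl⟩ := h
    rw [toSkew_t]
    exact Submodule.subset_span ⟨B, hB, _, rfl⟩
  | zero => rw [map_zero]; exact zero_mem _
  | add x y _ _ hx hy => rw [map_add]; exact add_mem hx hy
  | smul k x _ hx => rw [map_smul]; exact Submodule.smul_mem _ k hx

/-- The bisections `D ⊆ B` needed to decompose `a` inherit the degree of `B`. -/
lemma coeffToSteinberg_mem_component {γ : Γ} {B : HomBis c} (hB : B.HasDegree γ)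
    (a : (inducedAction R c).I B) : coeffToSteinberg R B a ∈ steinbergComponent R c γ := by
  have hle : Submodule.span R {a | ∃ D h, a = oneRangeOf R D B h} ≤
      (steinbergComponent R c γ).comap (coeffToSteinberg R B) := by
    refine Submodule.span_le.2 ?_
    rintro _ ⟨D, h, rfl⟩
    change coeffToSteinberg R B (oneRangeOf R D B h) ∈ steinbergComponent R c γ
    rw [coeffToSteinberg_oneRangeOf]
    exact Submodule.subset_span ⟨D, fun x hx => hB x (h x hx), rfl⟩
  exact hle (span_oneRangeOf_eq_top (R := R) B ▸ Submodule.mem_top)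

lemma ofSkew_mem_component {γ : Γ} {y : (inducedAction R c).SkewRing}
    (hy : y ∈ (inducedAction R c).component {B : HomBis c | B.HasDegree γ}) :
    ofSkew R c y ∈ steinbergComponent R c γ := by
  induction hy using Submodule.span_induction with
  | mem y h =>
    obtain ⟨B, hB, a, rfl⟩ := h
    rw [ofSkew_mkδ]
    exact coeffToSteinberg_mem_component hB a
  | zero => rw [map_zero]; exact zero_mem _
  | add x y _ _ hx hy => rw [map_add]; exact add_mem hx hy
  | smul k x _ hx => rw [map_smul]; exact Submodule.smul_mem _ k hx

variable (R c) in
lemma isAlgebraGrading_skewComponent :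
    IsAlgebraGrading
      (fun γ => (inducedAction R c).component {B : HomBis c | B.HasDegree γ}) where
  indep := by
    have h := (isAlgebraGrading_steinbergComponent R c).indep
    rw [iSupIndep_def] at h ⊢
    intro γ
    rw [Submodule.disjoint_def]
    intro y hy hy'
    -- Independence is pulled back from the Steinberg algebra: `ofSkew` carries components into
    -- components and has `toSkew` as a left inverse.
    have hle : (⨆ (β) (_ : β ≠ γ),
        (inducedAction R c).component {B : HomBis c | B.HasDegree β}) ≤
        (⨆ (β) (_ : β ≠ γ), steinbergComponent R c β).comap (ofSkew R c : _ →ₗ[R] _) :=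
      iSup₂_le fun β hβ z hz =>
        Submodule.mem_iSup_of_mem β (Submodule.mem_iSup_of_mem hβ (ofSkew_mem_component hz))
    rw [← toSkew_ofSkew y, Submodule.disjoint_def.1 (h γ) _ (ofSkew_mem_component hy) (hle hy'),
      map_zero]
  iSup_eq_top := by
    rw [eq_top_iff, ← span_mkδ_eq_top, Submodule.span_le]
    rintro _ ⟨B, a, rfl⟩
    obtain ⟨γ, hγ⟩ := B.graded
    exact Submodule.mem_iSup_of_mem γ (Submodule.subset_span ⟨B, hγ, a, rfl⟩)
  mul_mem β γ x y hx hy := by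
    refine mul_mem_of_mem_span ?_ hx hy
    rintro _ ⟨B, hB, a, rfl⟩ _ ⟨D, hD, b, rfl⟩
    rw [PartialAction.mkδ_mul_mkδ]
    exact Submodule.subset_span ⟨B * D, HomBis.HasDegree.mul hB hD, _, rfl⟩

end Action

end

end AmpleSkew

theorem theorem6p1 {R : Type*} [CommRing R] {Γ : Type*} [Group Γ]
    {G : Type*} [TopologicalSpace G] [T2Space G] [ArrowGroupoid G] [IsAmple G]
    (c : Cocycle G Γ) :
    -- both algebras are graded by the span of the homogeneous generators
    IsAlgebraGrading (steinbergComponent R c) ∧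
    IsAlgebraGrading
      (fun γ => (inducedAction R c).component {B : HomBis c | B.HasDegree γ}) ∧
    -- elements of the Steinberg algebra are determined by the functions on `G` they represent
    Function.Injective (steinbergEval R c) ∧
    ∃ (f : SteinbergAlgebra R c →ₙₐ[R] (inducedAction R c).SkewRing)
      (g : (inducedAction R c).SkewRing →ₙₐ[R] SteinbergAlgebra R c),
      g.comp f = NonUnitalAlgHom.id R _ ∧ f.comp g = NonUnitalAlgHom.id R _ ∧
      -- `f` and `g` preserve degrees
      (∀ γ, ∀ x ∈ steinbergComponent R c γ,
        f x ∈ (inducedAction R c).component {B : HomBis c | B.HasDegree γ}) ∧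
      (∀ γ, ∀ y ∈ (inducedAction R c).component {B : HomBis c | B.HasDegree γ},
        g y ∈ steinbergComponent R c γ) ∧
      -- `f` sends `t_D` to `1_{r(D)} δ_D`
      (∀ D : HomBis c, f (t R D) = (inducedAction R c).mkδ D (oneRange R D)) ∧
      -- `g (a δ_B)` is the function equal to `a ∘ r` on `B` and to `0` outside `B`
      (∀ (B : HomBis c) (a : (inducedAction R c).I B) (x : G),
        (x ∈ B → steinbergEval R c (g ((inducedAction R c).mkδ B a)) x =
          (a : CR R (unitSpace G)).1 (rMap x)) ∧
        (x ∉ B → steinbergEval R c (g ((inducedAction R c).mkδ B a)) x = 0)) := by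
  refine ⟨isAlgebraGrading_steinbergComponent R c, isAlgebraGrading_skewComponent R c,
    steinbergEval_injective R c, toSkew R c, ofSkew R c, NonUnitalAlgHom.ext ofSkew_toSkew,
    NonUnitalAlgHom.ext toSkew_ofSkew, fun _ _ => toSkew_mem_component,
    fun _ _ => ofSkew_mem_component, toSkew_t, fun B a x => ?_⟩
  rw [ofSkew_mkδ, steinbergEval_coeffToSteinberg]
  exact ⟨coeffEval_of_mem a, coeffEval_of_notMem a⟩
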